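/- Let $(R,\mu)$ be a $\sigma$-finite measure space and let $M=M(R,\mu)$ be the set of extended complex-valued $\mu$-measurable functions on $R$, functions equal $\mu$-a.e. being identified. For $f\in M$ put $\mu_f(s)=\mu(\{|f|>s\})$, $s\ge 0$, and $f^*(t)=\inf\{s\in[0,\infty):\mu_f(s)\le t\}$, $t\ge 0$. Let $\lambda$ be Lebesgue measure on $[0,\infty)$. The space $(R,\mu)$ is called resonant if $\sup_{\tilde g^*=g^*}\int_R|f\tilde g|\,d\mu=\int_0^\infty f^*g^*\,d\lambda$ for all $f,g\in M$; assume that $(R,\mu)$ is resonant. A functional $\|\cdot\|:M\to[0,\infty]$ with $\|\,|f|\,\|=\|f\|$ is a Banach function norm if, for all measurable $f,g,f_n\ge 0$: (P1) $\|af\|=|a|\|f\|$ for $a\in\mathbb{C}$, $\|f\|=0\Leftrightarrow f=0$ a.e., and $\|f+g\|\le\|f\|+\|g\|$; (P2) $f\le g$ a.e. implies $\|f\|\le\|g\|$; (P3) $f_n\uparrow f$ a.e. implies $\|f_n\|\uparrow\|f\|$; (P4) $\|\chi_E\|<\infty$ whenever $\mu(E)<\infty$; (P5) whenever $\mu(E)<\infty$,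 there is a finite $C_E$ with $\int_E f\,d\mu\le C_E\|f\|$ for all $f\ge0$. It is a quasi-Banach function norm if it satisfies (P2), (P3), (P4) and (P1) with the triangle inequality weakened to $\|f+g\|\le C(\|f\|+\|g\|)$ for some constant $C\ge1$. It is rearrangement-invariant (r.i.) if $\|f\|=\|g\|$ whenever $\mu_f=\mu_g$. Two functionals are equivalent if each is bounded by a constant multiple of the other. For a functional $\|\cdot\|_X$ put $X=\{f\in M:\|f\|_X<\infty\}$; $X\hookrightarrow Y$ means that $X\subseteq Y$ and the identity $X\to Y$ is continuous. For an r.i. quasi-Banach function norm $\|\cdot\|_X$ define the integrable norm $$\|f\|_{X_i}=\max\Big\{\|f\|_X,\ \|f^*\chi_{[0,1]}\|_{L^1(0,\infty)}+\|f^*\chi_{(1,\infty)}\|_{L^\infty(0,\infty)}\Big\},$$ the integrable associate norm $$\|f\|_{X_i'}=\sup\Big\{\tfrac{1}{\|g\|_{X_i}}\int_R|fg|\,d\mu:\ g\in M,\ \|g\|_{X_i}<\infty\Big\}\qquad\big(\tfrac00=0,\ \tfrac a0=\infty\text{ for }a>0\big),$$ and the second integrable associate norm $\|\cdot\|_{X_i''}$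 as the integrable associate norm of $\|\cdot\|_{X_i'}$; let $X_i''$ be the corresponding space. Theorem. Let $\|\cdot\|_X$ be an r.i. quasi-Banach function norm over the resonant space $(R,\mu)$ and let $X$ be the corresponding space. Then: 1. if $\|\cdot\|_X$ is a Banach function norm, then $X=X_i''$ with equivalent norms; 2. if $\|\cdot\|_X$ has the property (P5) but is not equivalent to a Banach function norm, then $X\hookrightarrow X_i''$ and $X_i''\not\hookrightarrow X$; 3. if $\|\cdot\|_X$ has the property (P1) but not the property (P5), then $X_i''\hookrightarrow X$ and $X\not\hookrightarrow X_i''$; 4. if $\|\cdot\|_X$ has neither (P1) nor (P5), then $X$ and $X_i''$ cannot, in general, be compared. Precisely, $([0,\infty),\lambda)$ is resonant, and for every $p\in(0,1)$ the functional $\|f\|_p=\big(\int_0^\infty|f|^p\,d\lambda\big)^{1/p}$ is an r.i. quasi-Banach function norm over it that has neither (P1) nor (P5), and both $L^p\not\subseteq(L^p)_i''$ and $(L^p)_i''\not\subseteq L^p$. -/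

import Mathlib

open MeasureTheory Filter Topology Set
open scoped ENNReal NNReal

namespace RIFunctionSpace

variable {R : Type*} [MeasurableSpace R]

/-! A functional `‖·‖ : M(R, μ) → [0, ∞]` with `‖ |f| ‖ = ‖f‖` is determined by its values on the
non-negative extended-valued functions, so it is represented by a map
`ρ : (R → ℝ≥0∞) → ℝ≥0∞`, of which only the values at `μ`-measurable functions
(`AEMeasurable f μ`) ever matter; `‖f‖` for a complex `f` is `ρ |f|`. Functions that agree
`μ`-a.e. have the same norm by the lattice property `P2`. -/

/-- The distribution function `μ_f(s) = μ {|f| > s}`, `s ∈ [0, ∞)`. -/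
noncomputable def distribution (μ : Measure R) (f : R → ℝ≥0∞) (s : ℝ≥0) : ℝ≥0∞ :=
  μ {x | (s : ℝ≥0∞) < f x}

/-- The non-increasing rearrangement `f^*(t) = inf {s ∈ [0, ∞) : μ_f(s) ≤ t}`, for `t ∈ [0, ∞)`
(with `inf ∅ = ∞`). It is only ever used for `t ≥ 0`. -/
noncomputable def rearrangement (μ : Measure R) (f : R → ℝ≥0∞) (t : ℝ) : ℝ≥0∞ :=
  ⨅ (s : ℝ≥0) (_ : distribution μ f s ≤ ENNReal.ofReal t), (s : ℝ≥0∞)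

/-- The Lebesgue measure on the half-line `[0, ∞)`. -/
noncomputable def halfLine : Measure ℝ := volume.restrict (Ici (0 : ℝ))

instance : SigmaFinite halfLine := by
  unfold halfLine; infer_instance

/-- A (sigma-finite) measure space is resonant if the supremum of `∫ |f g̃| dμ` over all `g̃`
with `g̃^* = g^*` is `∫_0^∞ f^* g^* dλ`, for all measurable `f`, `g`. -/
def IsResonant (μ : Measure R) : Prop :=
  ∀ f g : R → ℝ≥0∞, AEMeasurable f μ → AEMeasurable g μ →
    (⨆ (h : R → ℝ≥0∞) (_ : AEMeasurable h μ)
        (_ : ∀ t : ℝ, 0 ≤ t → rearrangement μ h t = rearrangement μ g t),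
      ∫⁻ x, f x * h x ∂μ)
    = ∫⁻ t, rearrangement μ f t * rearrangement μ g t ∂halfLine

/-- Axiom (P1): norm. -/
structure HasP1 (μ : Measure R) (ρ : (R → ℝ≥0∞) → ℝ≥0∞) : Prop where
  homogeneous : ∀ (a : ℝ≥0) (f : R → ℝ≥0∞), AEMeasurable f μ →
    ρ (fun x => a * f x) = a * ρ f
  eq_zero_iff : ∀ f : R → ℝ≥0∞, AEMeasurable f μ → (ρ f = 0 ↔ ∀ᵐ x ∂μ, f x = 0)
  subadditive : ∀ f g : R → ℝ≥0∞, AEMeasurable f μ → AEMeasurable g μ →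
    ρ (fun x => f x + g x) ≤ ρ f + ρ g

/-- Axiom (Q1): quasinorm. -/
structure HasQ1 (μ : Measure R) (ρ : (R → ℝ≥0∞) → ℝ≥0∞) : Prop where
  homogeneous : ∀ (a : ℝ≥0) (f : R → ℝ≥0∞), AEMeasurable f μ →
    ρ (fun x => a * f x) = a * ρ f
  eq_zero_iff : ∀ f : R → ℝ≥0∞, AEMeasurable f μ → (ρ f = 0 ↔ ∀ᵐ x ∂μ, f x = 0)
  quasi_subadditive : ∃ C : ℝ≥0, 1 ≤ C ∧
    ∀ f g : R → ℝ≥0∞, AEMeasurable f μ → AEMeasurable g μ →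
      ρ (fun x => f x + g x) ≤ C * (ρ f + ρ g)

/-- Axiom (P2): lattice property. -/
def HasP2 (μ : Measure R) (ρ : (R → ℝ≥0∞) → ℝ≥0∞) : Prop :=
  ∀ f g : R → ℝ≥0∞, AEMeasurable f μ → AEMeasurable g μ → (∀ᵐ x ∂μ, f x ≤ g x) → ρ f ≤ ρ g

/-- Axiom (P3): Fatou property. -/
def HasP3 (μ : Measure R) (ρ : (R → ℝ≥0∞) → ℝ≥0∞) : Prop :=
  ∀ (u : ℕ → R → ℝ≥0∞) (f : R → ℝ≥0∞), (∀ n, AEMeasurable (u n) μ) → AEMeasurable f μ →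
    (∀ᵐ x ∂μ, Monotone (fun n => u n x) ∧ Tendsto (fun n => u n x) atTop (𝓝 (f x))) →
    Monotone (fun n => ρ (u n)) ∧ Tendsto (fun n => ρ (u n)) atTop (𝓝 (ρ f))

/-- Axiom (P4): characteristic functions of sets of finite measure have finite norm. -/
def HasP4 (μ : Measure R) (ρ : (R → ℝ≥0∞) → ℝ≥0∞) : Prop :=
  ∀ E : Set R, MeasurableSet E → μ E < ∞ → ρ (E.indicator (fun _ => 1)) < ∞

/-- Axiom (P5): local embedding into `L^1`. -/
def HasP5 (μ : Measure R) (ρ : (R → ℝ≥0∞) → ℝ≥0∞) : Prop :=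
  ∀ E : Set R, MeasurableSet E → μ E < ∞ → ∃ C : ℝ≥0,
    ∀ f : R → ℝ≥0∞, AEMeasurable f μ → ∫⁻ x in E, f x ∂μ ≤ C * ρ f

/-- Banach function norms. -/
structure IsBanachFunctionNorm (μ : Measure R) (ρ : (R → ℝ≥0∞) → ℝ≥0∞) : Prop where
  p1 : HasP1 μ ρ
  p2 : HasP2 μ ρ
  p3 : HasP3 μ ρ
  p4 : HasP4 μ ρ
  p5 : HasP5 μ ρ

/-- Quasi-Banach function norms. -/
structure IsQuasiBanachFunctionNorm (μ : Measure R) (ρ : (R → ℝ≥0∞) → ℝ≥0∞) : Prop where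
  q1 : HasQ1 μ ρ
  p2 : HasP2 μ ρ
  p3 : HasP3 μ ρ
  p4 : HasP4 μ ρ

/-- Rearrangement invariance: equimeasurable functions have the same norm. -/
def IsRearrangementInvariant (μ : Measure R) (ρ : (R → ℝ≥0∞) → ℝ≥0∞) : Prop :=
  ∀ f g : R → ℝ≥0∞, AEMeasurable f μ → AEMeasurable g μ →
    (∀ s : ℝ≥0, distribution μ f s = distribution μ g s) → ρ f = ρ g

/-- Rearrangement-invariant quasi-Banach function norms. -/
structure IsRIQuasiBanachFunctionNorm (μ : Measure R) (ρ : (R → ℝ≥0∞) → ℝ≥0∞) : Prop where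
  quasiBanach : IsQuasiBanachFunctionNorm μ ρ
  invariant : IsRearrangementInvariant μ ρ

/-- Equivalence of two functionals on `M`. -/
def Equivalent (μ : Measure R) (ρ σ : (R → ℝ≥0∞) → ℝ≥0∞) : Prop :=
  ∃ C : ℝ≥0, 0 < C ∧ ∀ f : R → ℝ≥0∞, AEMeasurable f μ → ρ f ≤ C * σ f ∧ σ f ≤ C * ρ f

/-- The norm `ρ |f|` of a complex function. -/
noncomputable def cnorm {μ : Measure R} (ρ : (R → ℝ≥0∞) → ℝ≥0∞) (f : R →ₘ[μ] ℂ) : ℝ≥0∞ :=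
  ρ (fun x => ‖f x‖ₑ)

/-- The space `X = {f : ‖f‖_X < ∞}` of (classes of) functions. Functions of finite quasi-Banach
function norm are finite a.e., so complex-valued functions suffice. -/
def space (μ : Measure R) (ρ : (R → ℝ≥0∞) → ℝ≥0∞) : Set (R →ₘ[μ] ℂ) :=
  {f | cnorm ρ f < ∞}

/-- `X ↪ Y`: `X ⊆ Y` and the identity `X → Y` is continuous. The topology of a quasinormed space
is metrizable and its convergent sequences are those with `‖f_n - f‖ → 0`, so continuity is
sequential continuity. -/
def Embeds (μ : Measure R) (ρ σ : (R → ℝ≥0∞) → ℝ≥0∞) : Prop :=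
  space μ ρ ⊆ space μ σ ∧
    ∀ (u : ℕ → R →ₘ[μ] ℂ) (f : R →ₘ[μ] ℂ), (∀ n, u n ∈ space μ ρ) → f ∈ space μ ρ →
      Tendsto (fun n => cnorm ρ (u n - f)) atTop (𝓝 0) →
      Tendsto (fun n => cnorm σ (u n - f)) atTop (𝓝 0)

/-- The Lebesgue functional `‖·‖_p`. -/
noncomputable def lebesgueNorm (μ : Measure R) (p : ℝ≥0∞) (f : R → ℝ≥0∞) : ℝ≥0∞ :=
  eLpNorm f p μ

/-- The Wiener–Luxemburg quasinorm `‖f^* χ_[0,1]‖_A + ‖f^* χ_(1,∞)‖_B`, where `A`, `B` are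
functionals over `[0, ∞)`. -/
noncomputable def wienerLuxemburg (μ : Measure R) (A B : (ℝ → ℝ≥0∞) → ℝ≥0∞)
    (f : R → ℝ≥0∞) : ℝ≥0∞ :=
  A ((Icc (0 : ℝ) 1).indicator (rearrangement μ f)) +
    B ((Ioi (1 : ℝ)).indicator (rearrangement μ f))

/-- The integrable norm `‖f‖_{X_i} = max {‖f‖_X, ‖f‖_{WL(L^1, L^∞)}}`. -/
noncomputable def integrableNorm (μ : Measure R) (ρ : (R → ℝ≥0∞) → ℝ≥0∞)
    (f : R → ℝ≥0∞) : ℝ≥0∞ :=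
  max (ρ f) (wienerLuxemburg μ (lebesgueNorm halfLine 1) (lebesgueNorm halfLine ∞) f)

/-- The associate functional `‖f‖_{X'} = sup_{g ∈ X} ‖g‖_X⁻¹ ∫ |f g| dμ`. In `ℝ≥0∞`, as required,
`0 / 0 = 0` and `a / 0 = ∞` for `a > 0`. -/
noncomputable def associateNorm (μ : Measure R) (ρ : (R → ℝ≥0∞) → ℝ≥0∞)
    (f : R → ℝ≥0∞) : ℝ≥0∞ :=
  ⨆ (g : R → ℝ≥0∞) (_ : AEMeasurable g μ) (_ : ρ g < ∞), (∫⁻ x, f x * g x ∂μ) / ρ g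

/-- The integrable associate norm `‖·‖_{X_i'}`. -/
noncomputable def integrableAssociateNorm (μ : Measure R) (ρ : (R → ℝ≥0∞) → ℝ≥0∞) :
    (R → ℝ≥0∞) → ℝ≥0∞ :=
  associateNorm μ (integrableNorm μ ρ)

/-- The second integrable associate norm `‖·‖_{X_i''}`: the integrable associate norm of
`‖·‖_{X_i'}`. -/
noncomputable def secondIntegrableAssociateNorm (μ : Measure R) (ρ : (R → ℝ≥0∞) → ℝ≥0∞) :
    (R → ℝ≥0∞) → ℝ≥0∞ :=
  integrableAssociateNorm μ (integrableAssociateNorm μ ρ)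

end RIFunctionSpace

/-! Every comparison is an inequality between functionals up to a constant (`DominatedBy`). Write N
for the integrable norm, W for the functional of L^1 + L^∞ (`sumNorm`), and a prime for the
associate functional, so that the norm of X_i'' is max(N', W)'. By layer cake, W is comparable to
∫_0^1 f^*, which is ∫ min(μ_f(s), 1) ds.

Since W is part of the maximum, N always satisfies (P4) and (P5). Duality exchanges these two
axioms, so X_i'' always carries a Banach function norm.

If ρ has (P5), resonance turns the bound on one set of measure at least min(1, μ(R)) into W ≤ Cρ.
Then N is dominated by ρ, and max(N', W)' ≤ N'' ≤ N gives X ↪ X_i''. If ρ has (P1), the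
Lorentz–Luxemburg theorem gives ρ ≤ ρ''. Resonance and (P4) also bound W by N', and N' ≤ ρ', so ρ''
is dominated by max(N', W)'; hence X_i'' ↪ X. With both axioms the norms are equivalent.

The negative statements rest on `IsQuasiBanachFunctionNorm.dominatedBy_of_embeds`: a continuous
embedding forces a norm inequality. The reverse embedding would make ρ equivalent to the Banach
function norm of X_i'', or would pass (P5) from X_i'' to ρ.

For L^p with p < 1, x^(-1) on (0,1) is in L^p but not locally integrable, whereas x^(-1/p) on (1,∞)
is in L^1, hence in X_i'', but not in L^p. The half-line is resonant because ranking its points by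
the size of a simple f of bounded support is measure preserving, so g^* composed with the rank
attains the supremum. -/

namespace RIFunctionSpace

variable {R : Type*} [MeasurableSpace R]

/-! ### The layer cake formula -/

/-- Lebesgue measure on `ℝ≥0`. -/
noncomputable instance : MeasureSpace ℝ≥0 := ⟨Measure.comap ((↑) : ℝ≥0 → ℝ) volume⟩

theorem volume_setOf_coe_lt (a : ℝ≥0∞) : volume {s : ℝ≥0 | (s : ℝ≥0∞) < a} = a := by
  have hpre : (volume : Measure ℝ≥0) = Measure.comap ((↑) : ℝ≥0 → ℝ) volume := rfl
  have hemb : MeasurableEmbedding ((↑) : ℝ≥0 → ℝ) :=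
    MeasurableEmbedding.subtype_coe measurableSet_Ici
  rw [hpre, hemb.comap_apply]
  induction a with
  | top =>
    have : ((↑) : ℝ≥0 → ℝ) '' {s : ℝ≥0 | (s : ℝ≥0∞) < ∞} = Ici 0 := by
      ext x
      simp only [ENNReal.coe_lt_top, ofPred_true, image_univ, mem_range, mem_Ici]
      exact ⟨fun ⟨y, hy⟩ => hy ▸ y.2, fun h => ⟨⟨x, h⟩, rfl⟩⟩
    rw [this, Real.volume_Ici]
  | coe a =>
    have : ((↑) : ℝ≥0 → ℝ) '' {s : ℝ≥0 | (s : ℝ≥0∞) < a} = Ico 0 (a : ℝ) := by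
      ext x
      simp only [ENNReal.coe_lt_coe, mem_image, mem_ofPred_eq, mem_Ico]
      exact ⟨fun ⟨y, hy, h⟩ => h ▸ ⟨y.2, by exact_mod_cast hy⟩, fun h => ⟨⟨x, h.1⟩, h.2, rfl⟩⟩
    rw [this, Real.volume_Ico, sub_zero, ENNReal.ofReal_coe_nnreal]

instance : SigmaFinite (volume : Measure ℝ≥0) := by
  refine ⟨⟨⟨fun n => Iio (n : ℝ≥0), fun _ => trivial, fun n => ?_, ?_⟩⟩⟩
  · have := volume_setOf_coe_lt (n : ℝ≥0∞)
    have h : {s : ℝ≥0 | (s : ℝ≥0∞) < n} = Iio (n : ℝ≥0) := by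
      ext s; simp only [mem_ofPred_eq, mem_Iio]; exact_mod_cast Iff.rfl
    rw [← h, this]; exact ENNReal.natCast_lt_top n
  · rw [eq_univ_iff_forall]
    intro x
    obtain ⟨n, hn⟩ := exists_nat_gt x
    exact mem_iUnion.2 ⟨n, hn⟩

/-- Tonelli on the subgraph of a measurable version of `f`. -/
theorem lintegral_eq_lintegral_distribution (μ : Measure R) [SFinite μ] {f : R → ℝ≥0∞}
    (hf : AEMeasurable f μ) : ∫⁻ x, f x ∂μ = ∫⁻ s : ℝ≥0, distribution μ f s := by
  obtain ⟨g, hg, hfg⟩ := hf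
  have hdist : ∀ s, distribution μ f s = distribution μ g s := fun s => by
    refine measure_congr (eventuallyEq_set.2 ?_)
    filter_upwards [hfg] with x hx
    rw [hx]
  have hms : MeasurableSet {q : R × ℝ≥0 | (q.2 : ℝ≥0∞) < g q.1} :=
    measurableSet_lt (by fun_prop) (by fun_prop)
  rw [lintegral_congr_ae hfg]
  simp_rw [hdist]
  calc ∫⁻ x, g x ∂μ = ∫⁻ x, ∫⁻ s : ℝ≥0, 
          {q : R × ℝ≥0 | (q.2 : ℝ≥0∞) < g q.1}.indicator 1 (x, s) ∂volume ∂μ := by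
        refine lintegral_congr fun x => ?_
        rw [← volume_setOf_coe_lt (g x), ← lintegral_indicator_one]
        · rfl
        · exact measurableSet_lt (by fun_prop) (by fun_prop)
    _ = ∫⁻ s : ℝ≥0, ∫⁻ x, {q : R × ℝ≥0 | (q.2 : ℝ≥0∞) < g q.1}.indicator 1 (x, s) ∂μ := by
        apply lintegral_lintegral_swap
        exact ((measurable_const.indicator hms)).aemeasurable
    _ = _ := by
        refine lintegral_congr fun s => ?_
        have : MeasurableSet {x | (s : ℝ≥0∞) < g x} := measurableSet_lt (by fun_prop) hg
        rw [distribution, ← lintegral_indicator_one this]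
        rfl

theorem setLIntegral_eq_lintegral_distribution (μ : Measure R) [SFinite μ] {f : R → ℝ≥0∞}
    (hf : AEMeasurable f μ) (E : Set R) (hE : MeasurableSet E) :
    ∫⁻ x in E, f x ∂μ = ∫⁻ s : ℝ≥0, μ ({x | (s : ℝ≥0∞) < f x} ∩ E) := by
  rw [lintegral_eq_lintegral_distribution _ hf.restrict]
  simp only [distribution, Measure.restrict_apply' hE]

/-- Layer cake twice: for `f` against the measure with density `g`, then for `g` on each superlevel
set of `f`. Only `f` needs a strictly measurable version, since its superlevel sets serve as domains
of integration. -/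
theorem lintegral_mul_eq_lintegral_lintegral (μ : Measure R) [SFinite μ] {f g : R → ℝ≥0∞}
    (hf : AEMeasurable f μ) (hg : AEMeasurable g μ) :
    ∫⁻ x, f x * g x ∂μ =
      ∫⁻ s : ℝ≥0, ∫⁻ t : ℝ≥0, μ ({x | (s : ℝ≥0∞) < f x} ∩ {x | (t : ℝ≥0∞) < g x}) := by
  obtain ⟨f', hf', hff⟩ := hf
  have hset : ∀ s t : ℝ≥0, μ ({x | (s : ℝ≥0∞) < f x} ∩ {x | (t : ℝ≥0∞) < g x}) =
      μ ({x | (t : ℝ≥0∞) < g x} ∩ {x | (s : ℝ≥0∞) < f' x}) := fun s t => by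
    refine measure_congr (eventuallyEq_set.2 ?_)
    filter_upwards [hff] with x hx
    rw [mem_inter_iff, mem_inter_iff, mem_ofPred_eq, mem_ofPred_eq, mem_ofPred_eq, hx, and_comm]
  have h1 : ∫⁻ x, f x * g x ∂μ = ∫⁻ x, (g * f') x ∂μ :=
    lintegral_congr_ae (hff.mono fun x hx => by simp only [Pi.mul_apply, hx, mul_comm])
  simp_rw [hset]
  rw [h1, ← lintegral_withDensity_eq_lintegral_mul₀ hg hf'.aemeasurable,
    lintegral_eq_lintegral_distribution _ hf'.aemeasurable]
  refine lintegral_congr fun s => ?_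
  have hms : MeasurableSet {x | (s : ℝ≥0∞) < f' x} := measurableSet_lt (by fun_prop) hf'
  rw [distribution, withDensity_apply _ hms, setLIntegral_eq_lintegral_distribution μ hg _ hms]

/-! ### Distribution functions and rearrangements -/

theorem distribution_antitone (μ : Measure R) (f : R → ℝ≥0∞) : Antitone (distribution μ f) :=
  fun s t hst => measure_mono fun x hx => by
    rw [mem_ofPred_eq] at hx ⊢
    exact lt_of_le_of_lt (by exact_mod_cast hst) hx

theorem distribution_mono {μ : Measure R} {f g : R → ℝ≥0∞} (h : ∀ᵐ x ∂μ, f x ≤ g x) (s : ℝ≥0) :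
    distribution μ f s ≤ distribution μ g s :=
  measure_mono_ae (h.mono fun _ hx hs => lt_of_lt_of_le hs hx)

theorem distribution_indicator_one (μ : Measure R) (E : Set R) (s : ℝ≥0) :
    distribution μ (E.indicator fun _ => 1) s = if s < 1 then μ E else 0 := by
  unfold distribution
  split_ifs with h
  · congr 1
    ext x
    by_cases hx : x ∈ E <;> simp [hx, h]
  · convert measure_empty (μ := μ)
    ext x
    by_cases hx : x ∈ E <;> simp [hx, not_lt.1 h]

/-- The infimum is attained because the distribution function is right-continuous: {f > s} is the
increasing union of the sets {f > s + 1/(n+1)}. -/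
theorem rearrangement_le_iff (μ : Measure R) (f : R → ℝ≥0∞) (t : ℝ) (s : ℝ≥0) :
    rearrangement μ f t ≤ s ↔ distribution μ f s ≤ ENNReal.ofReal t := by
  refine ⟨fun h => ?_, fun h => iInf₂_le s h⟩
  have hU : {x | (s : ℝ≥0∞) < f x} = ⋃ n : ℕ, {x | ((s + 1 / (n + 1) : ℝ≥0) : ℝ≥0∞) < f x} := by
    ext x
    simp only [mem_ofPred_eq, mem_iUnion]
    refine ⟨fun hx => ?_, fun ⟨n, hn⟩ => lt_of_le_of_lt (by gcongr; exact le_self_add) hn⟩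
    obtain ⟨r, hr, hrx⟩ := ENNReal.lt_iff_exists_nnreal_btwn.1 hx
    have hr' : 0 < r - s := tsub_pos_of_lt (by exact_mod_cast hr)
    obtain ⟨n, hn⟩ := exists_nat_one_div_lt hr'
    refine ⟨n, lt_trans ?_ hrx⟩
    rw [ENNReal.coe_lt_coe]
    calc s + 1 / (n + 1) < s + (r - s) := by gcongr
      _ = r := add_tsub_cancel_of_le (by exact_mod_cast hr.le)
  have hmono : Monotone fun n : ℕ => {x | ((s + 1 / (n + 1) : ℝ≥0) : ℝ≥0∞) < f x} := by
    intro m n hmn x hx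
    simp only [mem_ofPred_eq] at hx ⊢
    refine lt_of_le_of_lt ?_ hx
    rw [ENNReal.coe_le_coe]
    gcongr
  rw [distribution, hU, hmono.measure_iUnion]
  refine iSup_le fun n => ?_
  have hlt : rearrangement μ f t < ((s + 1 / (n + 1) : ℝ≥0) : ℝ≥0∞) :=
    lt_of_le_of_lt h (by rw [ENNReal.coe_lt_coe]; exact lt_add_of_pos_right _ (by positivity))
  simp only [rearrangement, iInf_lt_iff] at hlt
  obtain ⟨s', hs', hlt⟩ := hlt
  exact (distribution_antitone μ f (by exact_mod_cast hlt.le)).trans hs'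

theorem lt_rearrangement_iff (μ : Measure R) (f : R → ℝ≥0∞) (t : ℝ) (s : ℝ≥0) :
    (s : ℝ≥0∞) < rearrangement μ f t ↔ ENNReal.ofReal t < distribution μ f s := by
  rw [← not_le, rearrangement_le_iff, not_le]

theorem rearrangement_antitone (μ : Measure R) (f : R → ℝ≥0∞) : Antitone (rearrangement μ f) :=
  fun _ _ hst => iInf₂_mono' fun s hs => ⟨s, hs.trans (ENNReal.ofReal_le_ofReal hst), le_rfl⟩

theorem measurable_rearrangement (μ : Measure R) (f : R → ℝ≥0∞) :
    Measurable (rearrangement μ f) :=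
  (rearrangement_antitone μ f).measurable

theorem rearrangement_eq_iff {S : Type*} [MeasurableSpace S] (μ : Measure R) (ν : Measure S)
    (f : R → ℝ≥0∞) (g : S → ℝ≥0∞) :
    (∀ t : ℝ, 0 ≤ t → rearrangement μ f t = rearrangement ν g t) ↔
      ∀ s, distribution μ f s = distribution ν g s := by
  constructor
  · intro h s
    refine ENNReal.eq_of_forall_le_nnreal_iff fun r => ?_
    have := h r r.2
    rw [← ENNReal.ofReal_coe_nnreal (p := r), ← rearrangement_le_iff, ← rearrangement_le_iff, this]
  · intro h t _
    simp only [rearrangement, h]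

theorem halfLine_setOf_ofReal_lt (a : ℝ≥0∞) : halfLine {t | ENNReal.ofReal t < a} = a := by
  rw [halfLine, Measure.restrict_apply' measurableSet_Ici]
  induction a with
  | top => simp
  | coe a =>
    have : {t : ℝ | ENNReal.ofReal t < a} ∩ Ici 0 = Ico 0 (a : ℝ) := by
      ext x
      simp only [mem_inter_iff, mem_ofPred_eq, mem_Ici, mem_Ico]
      constructor
      · rintro ⟨h, h0⟩
        refine ⟨h0, ?_⟩
        rwa [← ENNReal.ofReal_coe_nnreal, ENNReal.ofReal_lt_ofReal_iff_of_nonneg h0] at h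
      · rintro ⟨h0, h⟩
        exact ⟨by rwa [← ENNReal.ofReal_coe_nnreal, ENNReal.ofReal_lt_ofReal_iff_of_nonneg h0], h0⟩
    rw [this, Real.volume_Ico, sub_zero, ENNReal.ofReal_coe_nnreal]

/-- Superlevel sets of rearrangements are initial intervals of the half-line, so two of them
intersect in the shorter one. -/
theorem lintegral_rearrangement_mul (μ : Measure R) (f g : R → ℝ≥0∞) :
    ∫⁻ t, rearrangement μ f t * rearrangement μ g t ∂halfLine =
      ∫⁻ s : ℝ≥0, ∫⁻ t : ℝ≥0, min (distribution μ f s) (distribution μ g t) := by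
  rw [lintegral_mul_eq_lintegral_lintegral _ (measurable_rearrangement μ f).aemeasurable
    (measurable_rearrangement μ g).aemeasurable]
  refine lintegral_congr fun s => lintegral_congr fun t => ?_
  simp only [lt_rearrangement_iff, ← ofPred_and, ← lt_min_iff]
  exact halfLine_setOf_ofReal_lt _

/-- The functional `∫_0^m f^*`, expressed by the distribution function. -/
noncomputable def truncatedNorm (μ : Measure R) (m : ℝ≥0∞) (f : R → ℝ≥0∞) : ℝ≥0∞ :=
  ∫⁻ s : ℝ≥0, min (distribution μ f s) m

theorem lintegral_rearrangement_mul_indicator (μ : Measure R) (f : R → ℝ≥0∞) (E : Set R) :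
    ∫⁻ t, rearrangement μ f t * rearrangement μ (E.indicator fun _ => 1) t ∂halfLine =
      truncatedNorm μ (μ E) f := by
  rw [lintegral_rearrangement_mul]
  refine lintegral_congr fun s => ?_
  have : ∀ t : ℝ≥0, min (distribution μ f s) (distribution μ (E.indicator fun _ => 1) t) =
      {t : ℝ≥0 | (t : ℝ≥0∞) < 1}.indicator (fun _ => min (distribution μ f s) (μ E)) t := by
    intro t
    rw [distribution_indicator_one]
    by_cases h : t < 1 <;> simp [h]
  have hms : MeasurableSet {t : ℝ≥0 | (t : ℝ≥0∞) < 1} :=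
    measurableSet_lt (by fun_prop) measurable_const
  simp_rw [this]
  rw [lintegral_indicator hms, setLIntegral_const, volume_setOf_coe_lt, mul_one]

/-! ### Truncated norms and their comparison with L^1 + L^∞ -/

theorem setLIntegral_le_truncatedNorm (μ : Measure R) [SFinite μ] {f : R → ℝ≥0∞}
    (hf : AEMeasurable f μ) {E : Set R} (hE : MeasurableSet E) :
    ∫⁻ x in E, f x ∂μ ≤ truncatedNorm μ (μ E) f := by
  rw [setLIntegral_eq_lintegral_distribution μ hf E hE]
  exact lintegral_mono fun s => le_min (measure_mono inter_subset_left)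
    (measure_mono inter_subset_right)

theorem truncatedNorm_le (μ : Measure R) {m : ℝ≥0∞} (hm : m ≠ ∞) (f : R → ℝ≥0∞) :
    truncatedNorm μ m f ≤ max 1 m * truncatedNorm μ 1 f := by
  have hm' : max 1 m ≠ ∞ := by simp [hm]
  rw [truncatedNorm, truncatedNorm, ← lintegral_const_mul' _ _ hm']
  refine lintegral_mono fun s => ?_
  rcases le_total (distribution μ f s) 1 with h | h
  · calc min (distribution μ f s) m ≤ 1 * distribution μ f s := by simp
      _ ≤ max 1 m * min (distribution μ f s) 1 := by
        rw [min_eq_left h]; gcongr; exact le_max_left _ _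
  · rw [min_eq_right h, mul_one]
    exact (min_le_right _ _).trans (le_max_right _ _)

/-- A space of total mass below 1 has no set of measure 1, but capping at μ(R) loses nothing, as the
distribution function never exceeds it. -/
theorem truncatedNorm_one_le (μ : Measure R) {m : ℝ≥0∞} (hm : min 1 (μ univ) ≤ m)
    (f : R → ℝ≥0∞) : truncatedNorm μ 1 f ≤ truncatedNorm μ m f := by
  refine lintegral_mono fun s => le_min (min_le_left _ _) (le_trans ?_ hm)
  exact le_min (min_le_right _ _) ((min_le_left _ _).trans (measure_mono (subset_univ _)))

theorem exists_measurableSet_min_one_le (μ : Measure R) [SigmaFinite μ] :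
    ∃ E, MeasurableSet E ∧ μ E < ∞ ∧ min 1 (μ univ) ≤ μ E := by
  by_cases h : μ univ = ∞
  · have h1 : (1 : ℝ≥0∞) < ⨆ n, μ (spanningSets μ n) := by
      rw [← (monotone_spanningSets μ).measure_iUnion, iUnion_spanningSets, h]
      exact ENNReal.one_lt_top
    obtain ⟨n, hn⟩ := lt_iSup_iff.1 h1
    exact ⟨spanningSets μ n, measurableSet_spanningSets μ n, measure_spanningSets_lt_top μ n,
      (min_le_left _ _).trans hn.le⟩
  · exact ⟨univ, MeasurableSet.univ, lt_top_iff_ne_top.2 h, min_le_right _ _⟩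

/-- The Wiener–Luxemburg functional built from `L^1` and `L^∞`. -/
noncomputable abbrev sumNorm (μ : Measure R) : (R → ℝ≥0∞) → ℝ≥0∞ :=
  wienerLuxemburg μ (lebesgueNorm halfLine 1) (lebesgueNorm halfLine ∞)

theorem lebesgueNorm_one_rearrangement (μ : Measure R) (f : R → ℝ≥0∞) :
    lebesgueNorm halfLine 1 ((Icc (0 : ℝ) 1).indicator (rearrangement μ f)) =
      truncatedNorm μ 1 f := by
  have hms : MeasurableSet (Icc (0 : ℝ) 1) := measurableSet_Icc
  rw [lebesgueNorm, eLpNorm_one_eq_lintegral_enorm]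
  simp only [enorm_eq_self]
  rw [lintegral_indicator hms, setLIntegral_eq_lintegral_distribution halfLine
    (measurable_rearrangement μ f).aemeasurable _ hms]
  refine lintegral_congr fun s => ?_
  simp only [lt_rearrangement_iff]
  conv_rhs => rw [← halfLine_setOf_ofReal_lt (min _ _)]
  -- The closed interval [0,1] and the set where t < 1 agree up to the null set {1} and the negative
  -- axis.
  have hfin : ∀ᵐ x ∂halfLine, x ≠ 1 := by
    rw [halfLine]
    exact ae_restrict_of_ae (by simp [ae_iff])
  have hnn : ∀ᵐ x ∂halfLine, x ∈ Ici (0 : ℝ) := ae_restrict_mem measurableSet_Ici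
  refine measure_congr (eventuallyEq_set.2 ?_)
  filter_upwards [hfin, hnn] with x hx hx0
  rw [mem_inter_iff, mem_ofPred_eq, lt_min_iff, mem_Icc, ENNReal.ofReal_lt_one]
  exact (and_congr_right fun _ => ⟨fun h => lt_of_le_of_ne h.2 hx, fun h => ⟨hx0, h.le⟩⟩)

theorem truncatedNorm_one_le_sumNorm (μ : Measure R) (f : R → ℝ≥0∞) :
    truncatedNorm μ 1 f ≤ sumNorm μ f := by
  rw [← lebesgueNorm_one_rearrangement]
  exact le_self_add

/-- The value f^*(t) is the length of the set of s with μ_f(s) > t, and on that set min(μ_f(s), 1) =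
1. -/
theorem rearrangement_le_truncatedNorm (μ : Measure R) (f : R → ℝ≥0∞) {t : ℝ} (ht : 1 ≤ t) :
    rearrangement μ f t ≤ truncatedNorm μ 1 f := by
  have hms : MeasurableSet {s : ℝ≥0 | (s : ℝ≥0∞) < rearrangement μ f t} :=
    measurableSet_lt (by fun_prop) measurable_const
  conv_lhs => rw [← volume_setOf_coe_lt (rearrangement μ f t), ← lintegral_indicator_one hms]
  refine lintegral_mono fun s => ?_
  by_cases h : (s : ℝ≥0∞) < rearrangement μ f t
  · rw [indicator_of_mem (by exact h)]
    refine le_min ?_ le_rfl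
    rw [lt_rearrangement_iff] at h
    exact le_trans (by simpa using ht) h.le
  · rw [indicator_of_notMem (by exact h)]
    exact zero_le

theorem sumNorm_le_truncatedNorm_one (μ : Measure R) (f : R → ℝ≥0∞) :
    sumNorm μ f ≤ 2 * truncatedNorm μ 1 f := by
  rw [two_mul]
  refine add_le_add (lebesgueNorm_one_rearrangement μ f).le ?_
  rw [lebesgueNorm, eLpNorm_exponent_top, eLpNormEssSup]
  refine essSup_le_of_ae_le _ (Eventually.of_forall fun t => ?_)
  by_cases h : t ∈ Ioi (1 : ℝ)
  · simp only [enorm_eq_self, indicator_of_mem h]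
    exact rearrangement_le_truncatedNorm μ f h.le
  · simp [indicator_of_notMem h]

theorem truncatedNorm_indicator (μ : Measure R) (m : ℝ≥0∞) (E : Set R) :
    truncatedNorm μ m (E.indicator fun _ => 1) = min (μ E) m := by
  have : ∀ t : ℝ≥0, min (distribution μ (E.indicator fun _ => 1) t) m =
      {t : ℝ≥0 | (t : ℝ≥0∞) < 1}.indicator (fun _ => min (μ E) m) t := fun t => by
    rw [distribution_indicator_one]
    by_cases h : t < 1 <;> simp [h]
  have hms : MeasurableSet {t : ℝ≥0 | (t : ℝ≥0∞) < 1} :=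
    measurableSet_lt (by fun_prop) measurable_const
  simp_rw [truncatedNorm, this]
  rw [lintegral_indicator hms, setLIntegral_const, volume_setOf_coe_lt, mul_one]

/-! ### Domination of functionals -/

/-- `ρ ≤ C σ` for some constant `C`. -/
def DominatedBy (μ : Measure R) (ρ σ : (R → ℝ≥0∞) → ℝ≥0∞) : Prop :=
  ∃ C : ℝ≥0, 0 < C ∧ ∀ f : R → ℝ≥0∞, AEMeasurable f μ → ρ f ≤ C * σ f

variable {μ : Measure R} {ρ σ τ : (R → ℝ≥0∞) → ℝ≥0∞}

theorem DominatedBy.of_le (h : ∀ f, AEMeasurable f μ → ρ f ≤ σ f) : DominatedBy μ ρ σ :=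
  ⟨1, one_pos, fun f hf => by simpa using h f hf⟩

theorem DominatedBy.trans (h₁ : DominatedBy μ ρ σ) (h₂ : DominatedBy μ σ τ) :
    DominatedBy μ ρ τ := by
  obtain ⟨C, hC, h₁⟩ := h₁
  obtain ⟨D, hD, h₂⟩ := h₂
  refine ⟨C * D, mul_pos hC hD, fun f hf => (h₁ f hf).trans ?_⟩
  rw [ENNReal.coe_mul, mul_assoc]
  gcongr
  exact h₂ f hf

theorem DominatedBy.max_left (h₁ : DominatedBy μ ρ τ) (h₂ : DominatedBy μ σ τ) :
    DominatedBy μ (fun f => max (ρ f) (σ f)) τ := by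
  obtain ⟨C, hC, h₁⟩ := h₁
  obtain ⟨D, hD, h₂⟩ := h₂
  refine ⟨max C D, lt_max_of_lt_left hC, fun f hf => max_le ((h₁ f hf).trans ?_)
    ((h₂ f hf).trans ?_)⟩
  · gcongr; exact le_max_left _ _
  · gcongr; exact le_max_right _ _

theorem DominatedBy.le_max_left : DominatedBy μ ρ (fun f => max (ρ f) (σ f)) :=
  .of_le fun _ _ => _root_.le_max_left _ _

theorem DominatedBy.le_max_right : DominatedBy μ σ (fun f => max (ρ f) (σ f)) :=
  .of_le fun _ _ => _root_.le_max_right _ _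

theorem DominatedBy.equivalent (h₁ : DominatedBy μ ρ σ) (h₂ : DominatedBy μ σ ρ) :
    Equivalent μ ρ σ := by
  obtain ⟨C, hC, h₁⟩ := h₁
  obtain ⟨D, hD, h₂⟩ := h₂
  refine ⟨max C D, lt_max_of_lt_left hC, fun f hf => ⟨(h₁ f hf).trans ?_, (h₂ f hf).trans ?_⟩⟩
  · gcongr; exact _root_.le_max_left _ _
  · gcongr; exact _root_.le_max_right _ _

/-- A larger functional has fewer admissible test functions and larger denominators, so duality
reverses the inequality with the same constant. -/
theorem DominatedBy.associateNorm (h : DominatedBy μ ρ σ) :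
    DominatedBy μ (associateNorm μ σ) (associateNorm μ ρ) := by
  obtain ⟨C, hC, h⟩ := h
  refine ⟨C, hC, fun f _ => iSup₂_le fun g hg => iSup_le fun hgσ => ?_⟩
  have hρg : ρ g < ∞ := (h g hg).trans_lt (ENNReal.mul_lt_top ENNReal.coe_lt_top hgσ)
  calc (∫⁻ x, f x * g x ∂μ) / σ g ≤ (∫⁻ x, f x * g x ∂μ) / (ρ g / C) :=
        ENNReal.div_le_div_left (ENNReal.div_le_of_le_mul' (h g hg)) _
    _ = C * ((∫⁻ x, f x * g x ∂μ) / ρ g) := by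
        rw [div_eq_mul_inv, div_eq_mul_inv, div_eq_mul_inv, ENNReal.mul_inv
          (Or.inr (by simpa using hC.ne')) (Or.inr (by simp)), inv_inv]
        ring
    _ ≤ C * RIFunctionSpace.associateNorm μ ρ f := by
        gcongr
        exact le_iSup₂_of_le (f := fun g (_ : AEMeasurable g μ) =>
          ⨆ (_ : ρ g < ∞), (∫⁻ x, f x * g x ∂μ) / ρ g) g hg (le_iSup_of_le hρg le_rfl)

theorem HasP5.of_dominatedBy (h : HasP5 μ ρ) (hd : DominatedBy μ ρ σ) : HasP5 μ σ := by
  obtain ⟨D, _, hd⟩ := hd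
  intro E hE hE'
  obtain ⟨C, hC⟩ := h E hE hE'
  refine ⟨C * D, fun f hf => (hC f hf).trans ?_⟩
  rw [ENNReal.coe_mul, mul_assoc]
  gcongr
  exact hd f hf

/-! ### Associate functionals -/

theorem div_le_associateNorm (f : R → ℝ≥0∞) {g : R → ℝ≥0∞} (hg : AEMeasurable g μ)
    (hgρ : ρ g < ∞) : (∫⁻ x, f x * g x ∂μ) / ρ g ≤ associateNorm μ ρ f :=
  le_iSup₂_of_le (f := fun g (_ : AEMeasurable g μ) =>
    ⨆ (_ : ρ g < ∞), (∫⁻ x, f x * g x ∂μ) / ρ g) g hg (le_iSup_of_le hgρ le_rfl)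

theorem associateNorm_le {f : R → ℝ≥0∞} {c : ℝ≥0∞}
    (h : ∀ g, AEMeasurable g μ → ρ g < ∞ → (∫⁻ x, f x * g x ∂μ) / ρ g ≤ c) :
    associateNorm μ ρ f ≤ c :=
  iSup₂_le fun g hg => iSup_le fun hgρ => h g hg hgρ

/-- Hölder's inequality. The assumption `h0` excludes a nonzero `g` with ρ g = 0, for which the
right side could read ∞ * 0 = 0. -/
theorem lintegral_mul_le_associateNorm (f : R → ℝ≥0∞) {g : R → ℝ≥0∞} (hg : AEMeasurable g μ)
    (h0 : ρ g = 0 → ∀ᵐ x ∂μ, g x = 0) (hgρ : ρ g < ∞) :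
    ∫⁻ x, f x * g x ∂μ ≤ associateNorm μ ρ f * ρ g := by
  by_cases hz : ρ g = 0
  · rw [lintegral_congr_ae (g := 0) ((h0 hz).mono fun x hx => by simp [hx])]
    simp
  · exact (ENNReal.div_le_iff hz hgρ.ne).1 (div_le_associateNorm f hg hgρ)

theorem associateNorm_homogeneous (a : ℝ≥0) (f : R → ℝ≥0∞) :
    associateNorm μ ρ (fun x => a * f x) = a * associateNorm μ ρ f := by
  simp only [associateNorm, mul_assoc, lintegral_const_mul' _ _ (ENNReal.coe_ne_top (r := a)),
    mul_div_assoc, ENNReal.mul_iSup]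

theorem associateNorm_subadditive {f g : R → ℝ≥0∞} (hf : AEMeasurable f μ) :
    associateNorm μ ρ (fun x => f x + g x) ≤ associateNorm μ ρ f + associateNorm μ ρ g := by
  refine associateNorm_le fun h hh hhρ => ?_
  simp only [add_mul]
  rw [lintegral_add_left' (by fun_prop), ENNReal.add_div]
  exact add_le_add (div_le_associateNorm f hh hhρ) (div_le_associateNorm g hh hhρ)

theorem associateNorm_mono {f g : R → ℝ≥0∞} (h : ∀ᵐ x ∂μ, f x ≤ g x) :
    associateNorm μ ρ f ≤ associateNorm μ ρ g := by
  refine associateNorm_le fun k hk hkρ => le_trans ?_ (div_le_associateNorm g hk hkρ)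
  gcongr ?_ / _
  exact lintegral_mono_ae (h.mono fun x hx => by gcongr)

theorem associateNorm_hasP2 : HasP2 μ (associateNorm μ ρ) :=
  fun _ _ _ _ h => associateNorm_mono h

theorem associateNorm_hasP3 : HasP3 μ (associateNorm μ ρ) := by
  intro u f hu hf h
  have hmono : Monotone fun n => associateNorm μ ρ (u n) := fun m n hmn =>
    associateNorm_mono (h.mono fun x hx => hx.1 hmn)
  refine ⟨hmono, ?_⟩
  have : associateNorm μ ρ f = ⨆ n, associateNorm μ ρ (u n) := by
    refine le_antisymm (associateNorm_le fun g hg hgρ => ?_) (iSup_le fun n =>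
      associateNorm_mono (h.mono fun x hx => hx.1.ge_of_tendsto hx.2 n))
    have heq : ∫⁻ x, f x * g x ∂μ = ⨆ n, ∫⁻ x, u n x * g x ∂μ := by
      rw [← lintegral_iSup' (by fun_prop) (h.mono fun x hx m n hmn => by
        exact mul_le_mul_left (hx.1 hmn) (g x))]
      refine lintegral_congr_ae (h.mono fun x hx => ?_)
      dsimp only
      rw [← ENNReal.iSup_mul, iSup_eq_of_tendsto hx.1 hx.2]
    rw [heq, ENNReal.iSup_div]
    exact iSup_mono fun n => div_le_associateNorm (u n) hg hgρ
  rw [this]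
  exact tendsto_atTop_iSup hmono

/-- Functionals that satisfy (P5) separate points. -/
theorem HasP5.eq_zero [SigmaFinite μ] (h : HasP5 μ ρ) {f : R → ℝ≥0∞} (hf : AEMeasurable f μ)
    (h0 : ρ f = 0) : ∀ᵐ x ∂μ, f x = 0 := by
  have : ∀ n, ∀ᵐ x ∂μ.restrict (spanningSets μ n), f x = 0 := fun n => by
    obtain ⟨C, hC⟩ := h _ (measurableSet_spanningSets μ n) (measure_spanningSets_lt_top μ n)
    have h1 := hC f hf
    rw [h0, mul_zero, nonpos_iff_eq_zero, lintegral_eq_zero_iff' hf.restrict] at h1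
    exact h1
  rw [← ae_restrict_iUnion_iff, iUnion_spanningSets, Measure.restrict_univ] at this
  exact this

/-- Testing against χ_E exchanges (P4) and (P5): the constant of (P5) bounds the associate norm of
χ_E, and in the next lemma ρ(χ_E) is the (P5) constant of the associate functional. -/
theorem associateNorm_hasP4 (h : HasP5 μ ρ) : HasP4 μ (associateNorm μ ρ) := by
  intro E hE hE'
  obtain ⟨C, hC⟩ := h E hE hE'
  refine lt_of_le_of_lt (associateNorm_le (c := C) fun g hg _ => ?_) ENNReal.coe_lt_top
  refine ENNReal.div_le_of_le_mul (le_trans (le_of_eq ?_) (hC g hg))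
  rw [← lintegral_indicator hE]
  congr with x
  by_cases hx : x ∈ E <;> simp [hx]

theorem associateNorm_hasP5 [SigmaFinite μ] (h4 : HasP4 μ ρ) (h5 : HasP5 μ ρ) :
    HasP5 μ (associateNorm μ ρ) := by
  intro E hE hE'
  have h4 := h4 E hE hE'
  have hm : AEMeasurable (E.indicator fun _ => (1 : ℝ≥0∞)) μ :=
    (measurable_const.indicator hE).aemeasurable
  refine ⟨(ρ (E.indicator fun _ => 1)).toNNReal, fun f _ => ?_⟩
  rw [ENNReal.coe_toNNReal h4.ne, mul_comm, ← lintegral_indicator hE]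
  refine le_trans (le_of_eq ?_) (lintegral_mul_le_associateNorm f hm (h5.eq_zero hm) h4)
  congr with x
  by_cases hx : x ∈ E <;> simp [hx]

theorem associateNorm_eq_zero {f : R → ℝ≥0∞} (h : ∀ᵐ x ∂μ, f x = 0) :
    associateNorm μ ρ f = 0 := by
  rw [← nonpos_iff_eq_zero]
  refine associateNorm_le fun g _ _ => ?_
  rw [lintegral_congr_ae (g := 0) (h.mono fun x hx => by simp [hx])]
  simp

theorem associateNorm_isBanachFunctionNorm [SigmaFinite μ] (h4 : HasP4 μ ρ) (h5 : HasP5 μ ρ) :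
    IsBanachFunctionNorm μ (associateNorm μ ρ) where
  p1 := ⟨fun a f _ => associateNorm_homogeneous a f,
    fun _ hf => ⟨(associateNorm_hasP5 h4 h5).eq_zero hf, associateNorm_eq_zero⟩,
    fun _ _ hf _ => associateNorm_subadditive hf⟩
  p2 := associateNorm_hasP2
  p3 := associateNorm_hasP3
  p4 := associateNorm_hasP4 h5
  p5 := associateNorm_hasP5 h4 h5

theorem associateNorm_associateNorm_le (h0 : ∀ f, AEMeasurable f μ → ρ f = 0 → ∀ᵐ x ∂μ, f x = 0)
    {f : R → ℝ≥0∞} (hf : AEMeasurable f μ) :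
    associateNorm μ (associateNorm μ ρ) f ≤ ρ f := by
  rcases eq_or_ne (ρ f) ∞ with h | h
  · simp [h]
  refine associateNorm_le fun g _ _ => ENNReal.div_le_of_le_mul ?_
  simp only [mul_comm (f _)]
  rw [mul_comm]
  exact lintegral_mul_le_associateNorm g hf (h0 f hf) h.lt_top

/-! ### The Lorentz–Luxemburg theorem -/

theorem HasP2.congr (h : HasP2 μ ρ) {f g : R → ℝ≥0∞} (hf : AEMeasurable f μ)
    (hg : AEMeasurable g μ) (hfg : ∀ᵐ x ∂μ, f x = g x) : ρ f = ρ g :=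
  le_antisymm (h f g hf hg (hfg.mono fun _ hx => hx.le))
    (h g f hg hf (hfg.mono fun _ hx => hx.ge))

/-- Fatou's lemma for functionals with (P2) and (P3). -/
theorem HasP3.le_of_tendsto (h2 : HasP2 μ ρ) (h3 : HasP3 μ ρ) {u : ℕ → R → ℝ≥0∞}
    {f : R → ℝ≥0∞} (hu : ∀ n, AEMeasurable (u n) μ) (hf : AEMeasurable f μ)
    (hlim : ∀ᵐ x ∂μ, Tendsto (fun n => u n x) atTop (𝓝 (f x))) {c : ℝ≥0∞}
    (hc : ∀ n, ρ (u n) ≤ c) : ρ f ≤ c := by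
  have hm : ∀ n, AEMeasurable (fun x => ⨅ k, u (n + k) x) μ := fun n =>
    AEMeasurable.iInf fun k => hu (n + k)
  have hP := h3 (fun n x => ⨅ k, u (n + k) x) f hm hf (hlim.mono fun x hx => by
    have hmono : Monotone fun n => ⨅ k, u (n + k) x := fun m n hmn =>
      le_iInf fun k => iInf_le_of_le (n - m + k) (by rw [← add_assoc, Nat.add_sub_cancel' hmn])
    refine ⟨hmono, ?_⟩
    have h1 := hx.liminf_eq
    rw [liminf_eq_iSup_iInf_of_nat'] at h1
    rw [← h1]
    simp only [add_comm _ (_ : ℕ)] at hmono ⊢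
    exact tendsto_atTop_iSup hmono)
  refine le_of_tendsto' hP.2 fun n => le_trans ?_ (hc n)
  exact h2 _ _ (hm n) (hu n) (Eventually.of_forall fun x => iInf_le _ 0)

/-- Truncations of a function. -/
noncomputable def truncation (μ : Measure R) [SigmaFinite μ] (f : R → ℝ≥0∞) (n : ℕ) :
    R → ℝ≥0∞ :=
  (spanningSets μ n).indicator fun x => min (f x) n

section Truncation

variable [SigmaFinite μ] {f : R → ℝ≥0∞}

theorem aemeasurable_truncation (hf : AEMeasurable f μ) (n : ℕ) :
    AEMeasurable (truncation μ f n) μ :=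
  (hf.min aemeasurable_const).indicator (measurableSet_spanningSets μ n)

theorem truncation_le_natCast (n : ℕ) (x : R) : truncation μ f n x ≤ n := by
  by_cases hx : x ∈ spanningSets μ n <;> simp [truncation, hx]

theorem truncation_le (n : ℕ) (x : R) : truncation μ f n x ≤ f x := by
  by_cases hx : x ∈ spanningSets μ n <;> simp [truncation, hx]

theorem monotone_truncation (x : R) : Monotone fun n => truncation μ f n x := by
  intro m n hmn
  refine le_trans (indicator_le_indicator_of_subset (monotone_spanningSets μ hmn)
    (fun _ => zero_le) x) (indicator_le_indicator ?_)
  gcongr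

theorem tendsto_truncation (x : R) :
    Tendsto (fun n => truncation μ f n x) atTop (𝓝 (f x)) := by
  have h1 : Tendsto (fun n : ℕ => min (f x) n) atTop (𝓝 (min (f x) ∞)) :=
    tendsto_const_nhds.min ENNReal.tendsto_nat_nhds_top
  rw [min_eq_left le_top] at h1
  refine h1.congr' ?_
  obtain ⟨N, hN⟩ : ∃ N, x ∈ spanningSets μ N := by
    exact mem_iUnion.1 ((iUnion_spanningSets μ).ge (mem_univ x))
  filter_upwards [eventually_ge_atTop N] with n hn
  rw [truncation, indicator_of_mem (monotone_spanningSets μ hn hN)]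

theorem memLp_truncation (hf : AEMeasurable f μ) (n : ℕ) :
    MemLp (fun x => (truncation μ f n x).toReal) 2 μ := by
  have h1 : MemLp ((spanningSets μ n).indicator fun _ => (n : ℝ)) 2 μ :=
    memLp_indicator_const 2 (measurableSet_spanningSets μ n) _
      (Or.inr (measure_spanningSets_lt_top μ n).ne)
  refine h1.mono (aemeasurable_truncation hf n).ennreal_toReal.aestronglyMeasurable
    (Eventually.of_forall fun x => ?_)
  by_cases hx : x ∈ spanningSets μ n
  · simp only [truncation, indicator_of_mem hx, Real.norm_eq_abs, ENNReal.abs_toReal, Nat.abs_cast]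
    exact ENNReal.toReal_le_of_le_ofReal (by positivity) (by simp)
  · simp [truncation, hx]

end Truncation

/-- The ball of radius `r` in `L^2 ∩ X`. -/
def squareBall (μ : Measure R) (ρ : (R → ℝ≥0∞) → ℝ≥0∞) (r : ℝ≥0) : Set (Lp ℝ 2 μ) :=
  {h | ρ (fun x => ‖h x‖ₑ) ≤ r}

theorem aemeasurable_enorm_Lp (h : Lp ℝ 2 μ) : AEMeasurable (fun x => ‖h x‖ₑ) μ :=
  (Lp.aestronglyMeasurable h).enorm

theorem convex_squareBall (h1 : HasP1 μ ρ) (h2 : HasP2 μ ρ) (r : ℝ≥0) :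
    Convex ℝ (squareBall μ ρ r) := by
  intro f hf g hg a b ha hb hab
  lift a to ℝ≥0 using ha
  lift b to ℝ≥0 using hb
  have hf' := aemeasurable_enorm_Lp f
  have hg' := aemeasurable_enorm_Lp g
  have hpt : ∀ᵐ x ∂μ, ‖((a : ℝ) • f + (b : ℝ) • g) x‖ₑ ≤ a * ‖f x‖ₑ + b * ‖g x‖ₑ := by
    filter_upwards [Lp.coeFn_add ((a : ℝ) • f) ((b : ℝ) • g), Lp.coeFn_smul (a : ℝ) f,
      Lp.coeFn_smul (b : ℝ) g] with x e1 e2 e3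
    rw [e1, Pi.add_apply, e2, e3, Pi.smul_apply, Pi.smul_apply]
    refine (enorm_add_le _ _).trans (le_of_eq ?_)
    simp only [enorm_smul, Real.enorm_of_nonneg (NNReal.coe_nonneg _), ENNReal.ofReal_coe_nnreal]
  calc ρ (fun x => ‖((a : ℝ) • f + (b : ℝ) • g) x‖ₑ)
      ≤ ρ (fun x => a * ‖f x‖ₑ + b * ‖g x‖ₑ) :=
        h2 _ _ (aemeasurable_enorm_Lp _) (by fun_prop) hpt
    _ ≤ ρ (fun x => a * ‖f x‖ₑ) + ρ (fun x => b * ‖g x‖ₑ) :=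
        h1.subadditive _ _ (by fun_prop) (by fun_prop)
    _ ≤ a * r + b * r := by
        rw [h1.homogeneous a _ hf', h1.homogeneous b _ hg']
        gcongr
        · exact hf
        · exact hg
    _ = r := by
        rw [← add_mul]
        have : a + b = 1 := by exact_mod_cast hab
        rw [← ENNReal.coe_add, this, ENNReal.coe_one, one_mul]

/-- An L^2-convergent sequence has a subsequence converging a.e., to which the Fatou property
applies. -/
theorem isClosed_squareBall (h2 : HasP2 μ ρ) (h3 : HasP3 μ ρ) (r : ℝ≥0) :
    IsClosed (squareBall μ ρ r) := by
  refine isSeqClosed_iff_isClosed.1 fun u f hu hlim => ?_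
  obtain ⟨ns, -, hns⟩ := (tendstoInMeasure_of_tendsto_Lp hlim).exists_seq_tendsto_ae
  exact HasP3.le_of_tendsto h2 h3 (fun n => aemeasurable_enorm_Lp (u (ns n)))
    (aemeasurable_enorm_Lp f) (hns.mono fun x hx => hx.enorm) fun n => hu (ns n)

theorem Lp_inner_toLp_eq_integral (k : Lp ℝ 2 μ) {h : R → ℝ} (hh : MemLp h 2 μ) :
    inner ℝ k hh.toLp = ∫ x, h x * k x ∂μ := by
  rw [L2.inner_def]
  refine integral_congr_ae (hh.coeFn_toLp.mono fun x hx => ?_)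
  simp only [hx]
  simp

/-- A functional bounded on the ball of `L^2 ∩ X` is represented by a function of
bounded associate norm. -/
theorem lintegral_mul_enorm_le [SigmaFinite μ] (h2 : HasP2 μ ρ) {r : ℝ≥0} (k : Lp ℝ 2 μ)
    {u : ℝ} (hu : ∀ h ∈ squareBall μ ρ r, inner ℝ k h ≤ u) {f : R → ℝ≥0∞}
    (hf : AEMeasurable f μ) (hfr : ρ f ≤ r) :
    ∫⁻ x, f x * ‖k x‖ₑ ∂μ ≤ ENNReal.ofReal u := by
  have hk : AEMeasurable (fun x => ‖k x‖ₑ) μ := aemeasurable_enorm_Lp k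
  have key : ∀ n, ∫⁻ x, truncation μ f n x * ‖k x‖ₑ ∂μ ≤ ENNReal.ofReal u := by
    intro n
    have hn := memLp_truncation hf n
    have hne : ∀ x, truncation μ f n x ≠ ∞ := fun x =>
      ((truncation_le_natCast n x).trans_lt (ENNReal.natCast_lt_top n)).ne
    have hkm := (Lp.aestronglyMeasurable k).aemeasurable
    -- The sign of `k`, set to 1 at 0 so that its modulus is 1 everywhere. Multiplying the
    -- truncation by it keeps it in the ball and turns the inner product with `k` into an integral
    -- against |k|.
    have hs : Measurable fun y : ℝ => if 0 ≤ y then (1 : ℝ) else -1 :=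
      Measurable.ite measurableSet_Ici measurable_const measurable_const
    have hse : ∀ y : ℝ, ‖if 0 ≤ y then (1 : ℝ) else -1‖ₑ = 1 := fun y => by split_ifs <;> simp
    have hsn : ∀ y : ℝ, ‖if 0 ≤ y then (1 : ℝ) else -1‖ = 1 := fun y => by split_ifs <;> simp
    have he : MemLp (fun x => (truncation μ f n x).toReal * if 0 ≤ k x then (1 : ℝ) else -1) 2 μ :=
      hn.mono (hn.aestronglyMeasurable.mul (hs.comp_aemeasurable hkm).aestronglyMeasurable)
        (Eventually.of_forall fun x => by rw [norm_mul, hsn, mul_one])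
    have hmem : he.toLp ∈ squareBall μ ρ r := by
      refine (h2 _ _ (aemeasurable_enorm_Lp _) hf ?_).trans hfr
      filter_upwards [he.coeFn_toLp] with x hx
      rw [hx, enorm_mul, hse, mul_one,
        Real.enorm_of_nonneg ENNReal.toReal_nonneg, ENNReal.ofReal_toReal (hne x)]
      exact truncation_le n x
    have hle := hu _ hmem
    rw [Lp_inner_toLp_eq_integral] at hle
    have hint : Integrable (fun x => (truncation μ f n x).toReal * |k x|) μ :=
      hn.integrable_mul (Lp.memLp k).abs
    have heq : ∀ x, ((truncation μ f n x).toReal * if 0 ≤ k x then (1 : ℝ) else -1) * k x =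
        (truncation μ f n x).toReal * |k x| := fun x => by
      split_ifs with h
      · rw [abs_of_nonneg h, mul_one]
      · rw [abs_of_neg (not_le.1 h)]; ring
    simp only [heq] at hle
    refine le_trans (le_of_eq ?_) (ENNReal.ofReal_le_ofReal hle)
    rw [ofReal_integral_eq_lintegral_ofReal hint (Eventually.of_forall fun x => by positivity)]
    refine lintegral_congr fun x => ?_
    rw [ENNReal.ofReal_mul ENNReal.toReal_nonneg, ENNReal.ofReal_toReal (hne x),
      Real.enorm_eq_ofReal_abs]
  have ht : Tendsto (fun n => ∫⁻ x, truncation μ f n x * ‖k x‖ₑ ∂μ) atTop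
      (𝓝 (∫⁻ x, f x * ‖k x‖ₑ ∂μ)) := by
    refine lintegral_tendsto_of_tendsto_of_monotone
      (fun n => (aemeasurable_truncation hf n).mul hk)
      (Eventually.of_forall fun x m n hmn => mul_le_mul_left (monotone_truncation x hmn) _)
      (Eventually.of_forall fun x => ?_)
    exact ENNReal.Tendsto.mul_const (tendsto_truncation x) (Or.inr (by simp))
  exact le_of_tendsto' ht key

theorem HasP1.associateNorm_le_div (h1 : HasP1 μ ρ) {w : R → ℝ≥0∞} {r : ℝ≥0} (hr : 0 < r)
    {u : ℝ≥0∞}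
    (h : ∀ f : R → ℝ≥0∞, AEMeasurable f μ → ρ f ≤ r → ∫⁻ x, f x * w x ∂μ ≤ u) :
    associateNorm μ ρ w ≤ u / r := by
  have hr0 : (r : ℝ≥0∞) ≠ 0 := by exact_mod_cast hr.ne'
  refine associateNorm_le fun f hf hfρ => ?_
  by_cases hz : ρ f = 0
  · rw [lintegral_congr_ae (g := 0) (((h1.eq_zero_iff f hf).1 hz).mono fun x hx => by simp [hx])]
    simp
  lift ρ f to ℝ≥0 using hfρ.ne with c hc
  have hc0 : c ≠ 0 := by simpa using hz
  -- Rescaling gives the test function norm exactly `r`.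
  have := h (fun x => ((r / c : ℝ≥0) : ℝ≥0∞) * f x) (by fun_prop) (by
    rw [h1.homogeneous _ _ hf, ← hc, ← ENNReal.coe_mul, div_mul_cancel₀ _ hc0])
  simp only [mul_assoc] at this
  rw [lintegral_const_mul' _ _ ENNReal.coe_ne_top, ENNReal.coe_div hc0] at this
  rw [ENNReal.le_div_iff_mul_le (Or.inl hr0) (Or.inl ENNReal.coe_ne_top)]
  refine le_trans (le_of_eq ?_) this
  simp only [mul_comm (w _), div_eq_mul_inv]
  ring

/-- The Lorentz–Luxemburg theorem. -/
theorem le_associateNorm_associateNorm [SigmaFinite μ] (h1 : HasP1 μ ρ) (h2 : HasP2 μ ρ)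
    (h3 : HasP3 μ ρ) {f : R → ℝ≥0∞} (hf : AEMeasurable f μ) :
    ρ f ≤ associateNorm μ (associateNorm μ ρ) f := by
  have hlim := h3 (truncation μ f) f (aemeasurable_truncation hf) hf
    (Eventually.of_forall fun x => ⟨monotone_truncation x, tendsto_truncation x⟩)
  refine le_of_tendsto' hlim.2 fun n => ?_
  refine le_trans ?_ (associateNorm_mono (Eventually.of_forall fun x => truncation_le (μ := μ) n x))
  -- Otherwise some `r` lies strictly between the two norms of the truncation, which is then a point
  -- of L^2 outside the closed convex ball of radius `r`. Hahn–Banach and Riesz representation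
  -- separate it by some `k` in L^2.
  by_contra! hlt
  obtain ⟨r, hr₁, hr₂⟩ := ENNReal.lt_iff_exists_nnreal_btwn.1 hlt
  have hr : 0 < r := by exact_mod_cast (zero_le.trans_lt hr₁)
  have hn := memLp_truncation hf n
  have hne : ∀ x, truncation μ f n x ≠ ∞ := fun x =>
    ((truncation_le_natCast n x).trans_lt (ENNReal.natCast_lt_top n)).ne
  have hnot : hn.toLp ∉ squareBall μ ρ r := by
    intro hmem
    refine (hr₂.trans_le ?_).not_ge hmem
    refine (h2.congr (aemeasurable_truncation hf n) (aemeasurable_enorm_Lp _) ?_).le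
    filter_upwards [hn.coeFn_toLp] with x hx
    rw [hx, Real.enorm_of_nonneg ENNReal.toReal_nonneg, ENNReal.ofReal_toReal (hne x)]
  obtain ⟨φ, u, hφ, hu⟩ := geometric_hahn_banach_closed_point (convex_squareBall h1 h2 r)
    (isClosed_squareBall h2 h3 r) hnot
  obtain ⟨k, hk⟩ := (InnerProductSpace.toDual ℝ (Lp ℝ 2 μ)).surjective φ
  have hφk : ∀ h, φ h = inner ℝ k h := fun h => by
    rw [← hk, InnerProductSpace.toDual_apply_apply]
  have hu0 : 0 < u := by
    have h0 : (0 : Lp ℝ 2 μ) ∈ squareBall μ ρ r := by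
      have : ρ (fun x => ‖(0 : Lp ℝ 2 μ) x‖ₑ) = 0 :=
        (h1.eq_zero_iff _ (aemeasurable_enorm_Lp _)).2
          ((Lp.coeFn_zero ℝ 2 μ).mono fun x hx => by rw [hx, Pi.zero_apply, enorm_zero])
      exact this.le.trans zero_le
    simpa using hφ 0 h0
  have hkm : AEMeasurable (fun x => ‖k x‖ₑ) μ := aemeasurable_enorm_Lp k
  have hw : associateNorm μ ρ (fun x => ‖k x‖ₑ) ≤ ENNReal.ofReal u / r :=
    h1.associateNorm_le_div hr fun g hg hgr =>
      lintegral_mul_enorm_le h2 k (fun h hh => hφk h ▸ (hφ h hh).le) hg hgr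
  have hge : ENNReal.ofReal u ≤ ∫⁻ x, truncation μ f n x * ‖k x‖ₑ ∂μ := by
    rw [hφk, Lp_inner_toLp_eq_integral] at hu
    refine (ENNReal.ofReal_le_ofReal hu.le).trans ?_
    refine (ENNReal.ofReal_le_ofReal (le_abs_self _)).trans ?_
    rw [← Real.enorm_eq_ofReal_abs]
    refine (enorm_integral_le_lintegral_enorm _).trans (le_of_eq ?_)
    refine lintegral_congr fun x => ?_
    rw [enorm_mul, Real.enorm_of_nonneg ENNReal.toReal_nonneg, ENNReal.ofReal_toReal (hne x)]
  have hr0 : (r : ℝ≥0∞) ≠ 0 := by exact_mod_cast hr.ne'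
  have hu0' : ENNReal.ofReal u ≠ 0 := by simpa using hu0
  refine hr₁.not_ge ?_
  -- Testing with |k|: the integral is at least `u`, while the associate norm of |k| is at most u /
  -- r. The quotient is therefore at least `r`, against the choice of `r`.
  calc (r : ℝ≥0∞) = ENNReal.ofReal u / (ENNReal.ofReal u / r) := by
        rw [ENNReal.div_div_cancel hu0' ENNReal.ofReal_ne_top]
    _ ≤ (∫⁻ x, truncation μ f n x * ‖k x‖ₑ ∂μ) / associateNorm μ ρ (fun x => ‖k x‖ₑ) :=
        ENNReal.div_le_div hge hw
    _ ≤ _ := div_le_associateNorm _ hkm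
        (hw.trans_lt (ENNReal.div_lt_top ENNReal.ofReal_ne_top hr0))

/-! ### Embeddings -/

theorem aemeasurable_enorm_aeeqFun (f : R →ₘ[μ] ℂ) : AEMeasurable (fun x => ‖f x‖ₑ) μ :=
  f.aestronglyMeasurable.enorm

theorem IsBanachFunctionNorm.isQuasiBanachFunctionNorm (h : IsBanachFunctionNorm μ ρ) :
    IsQuasiBanachFunctionNorm μ ρ :=
  ⟨⟨h.p1.homogeneous, h.p1.eq_zero_iff,
    1, le_rfl, fun f g hf hg => by simpa using h.p1.subadditive f g hf hg⟩, h.p2, h.p3, h.p4⟩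

theorem Equivalent.space_eq (h : Equivalent μ ρ σ) : space μ ρ = space μ σ := by
  obtain ⟨C, _, h⟩ := h
  ext f
  have := h _ (aemeasurable_enorm_aeeqFun f)
  exact ⟨fun hf => this.2.trans_lt (ENNReal.mul_lt_top ENNReal.coe_lt_top hf),
    fun hf => this.1.trans_lt (ENNReal.mul_lt_top ENNReal.coe_lt_top hf)⟩

theorem DominatedBy.embeds (h : DominatedBy μ σ ρ) : Embeds μ ρ σ := by
  obtain ⟨C, _, h⟩ := h
  refine ⟨fun f hf => (h _ (aemeasurable_enorm_aeeqFun f)).trans_lt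
    (ENNReal.mul_lt_top ENNReal.coe_lt_top hf), fun u f _ _ ht => ?_⟩
  have h0 := ENNReal.Tendsto.const_mul ht (Or.inr (ENNReal.coe_ne_top (r := C)))
  rw [mul_zero] at h0
  exact tendsto_of_tendsto_of_tendsto_of_le_of_le tendsto_const_nhds h0 (fun _ => zero_le)
    fun n => h _ (aemeasurable_enorm_aeeqFun (u n - f))

/-- Functions of finite norm are finite almost everywhere. -/
theorem IsQuasiBanachFunctionNorm.ae_lt_top (h : IsQuasiBanachFunctionNorm μ ρ)
    {f : R → ℝ≥0∞} (hf : AEMeasurable f μ) (hfρ : ρ f < ∞) : ∀ᵐ x ∂μ, f x < ∞ := by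
  obtain ⟨g, hg, hfg⟩ := hf
  have hgρ : ρ g < ∞ := by rwa [h.p2.congr hg.aemeasurable ⟨g, hg, hfg⟩ hfg.symm]
  have hE : MeasurableSet (g ⁻¹' {∞}) := hg (measurableSet_singleton _)
  have hm : AEMeasurable ((g ⁻¹' {∞}).indicator fun _ => (1 : ℝ≥0∞)) μ :=
    (measurable_const.indicator hE).aemeasurable
  -- Every multiple n χ of the characteristic function of {g = ∞} lies below `g`, which forces that
  -- function to have norm zero.
  have hle : ∀ n : ℕ, n * ρ ((g ⁻¹' {∞}).indicator fun _ => 1) ≤ ρ g := fun n => by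
    have := h.q1.homogeneous n _ hm
    rw [ENNReal.coe_natCast] at this
    rw [← this]
    refine h.p2 _ _ (by fun_prop) hg.aemeasurable (Eventually.of_forall fun x => ?_)
    by_cases hx : g x = ∞ <;> simp [hx]
  have hz : ρ ((g ⁻¹' {∞}).indicator fun _ => 1) = 0 := by
    by_contra hne
    obtain ⟨n, hn⟩ := ENNReal.exists_nat_mul_gt hne hgρ.ne
    exact (hle n).not_gt hn
  filter_upwards [hfg, (h.q1.eq_zero_iff _ hm).1 hz] with x hx hx0
  rw [hx, lt_top_iff_ne_top]
  intro htop
  simp [htop] at hx0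

theorem exists_aeeqFun_enorm_eq {f : R → ℝ≥0∞} (hf : AEMeasurable f μ)
    (hfin : ∀ᵐ x ∂μ, f x < ∞) : ∃ F : R →ₘ[μ] ℂ, ∀ᵐ x ∂μ, ‖F x‖ₑ = f x := by
  have hm : AEStronglyMeasurable (fun x => (((f x).toReal : ℝ) : ℂ)) μ := by
    have := hf.ennreal_toReal
    exact (Complex.measurable_ofReal.comp_aemeasurable this).aestronglyMeasurable
  refine ⟨AEEqFun.mk _ hm, ?_⟩
  filter_upwards [AEEqFun.coeFn_mk _ hm, hfin] with x hx hfx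
  rw [hx, ← ofReal_norm, Complex.norm_real, Real.norm_of_nonneg ENNReal.toReal_nonneg,
    ENNReal.ofReal_toReal hfx.ne]

/-- If no constant works, homogeneity yields F_n with σ-norm 1 and ρ-norm at most 1/(n+1). This
sequence tends to 0 in the first space but not in the second. -/
theorem IsQuasiBanachFunctionNorm.dominatedBy_of_embeds (hρ : IsQuasiBanachFunctionNorm μ ρ)
    (hσ : IsQuasiBanachFunctionNorm μ σ) (h : Embeds μ ρ σ) : DominatedBy μ σ ρ := by
  by_contra hnd
  have hex : ∀ n : ℕ, ∃ F : R →ₘ[μ] ℂ, cnorm ρ F ≤ ((n + 1 : ℝ≥0) : ℝ≥0∞)⁻¹ ∧ cnorm σ F = 1 := by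
    intro n
    have : ∃ f, AEMeasurable f μ ∧ ((n + 1 : ℝ≥0) : ℝ≥0∞) * ρ f < σ f := by
      by_contra! hall
      exact hnd ⟨n + 1, by positivity, hall⟩
    obtain ⟨f, hf, hlt⟩ := this
    have hn0 : ((n + 1 : ℝ≥0) : ℝ≥0∞) ≠ 0 := by
      rw [ENNReal.coe_ne_zero]; positivity
    have hρf : ρ f < ∞ := by
      refine lt_top_iff_ne_top.2 fun htop => ?_
      rw [htop, ENNReal.mul_top hn0] at hlt
      exact not_top_lt hlt
    have hfin := hρ.ae_lt_top hf hρf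
    -- The inclusion of the spaces makes σ f finite, so that `f` can be normalised.
    have hσf : σ f < ∞ := by
      obtain ⟨F, hF⟩ := exists_aeeqFun_enorm_eq hf hfin
      have hmem : F ∈ space μ ρ := by
        change ρ _ < ∞
        rwa [hρ.p2.congr (aemeasurable_enorm_aeeqFun F) hf hF]
      have := h.1 hmem
      change σ _ < ∞ at this
      rwa [hσ.p2.congr (aemeasurable_enorm_aeeqFun F) hf hF] at this
    have hσ0 : σ f ≠ 0 := (zero_le.trans_lt hlt).ne'
    obtain ⟨c, hc⟩ : ∃ c : ℝ≥0, (c : ℝ≥0∞) = (σ f)⁻¹ :=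
      ⟨(σ f)⁻¹.toNNReal, ENNReal.coe_toNNReal (ENNReal.inv_ne_top.2 hσ0)⟩
    have hcf : AEMeasurable (fun x => c * f x) μ := by fun_prop
    obtain ⟨F, hF⟩ := exists_aeeqFun_enorm_eq hcf
      (hfin.mono fun x hx => ENNReal.mul_lt_top ENNReal.coe_lt_top hx)
    refine ⟨F, ?_, ?_⟩
    · rw [cnorm, hρ.p2.congr (aemeasurable_enorm_aeeqFun F) hcf hF, hρ.q1.homogeneous c f hf, hc,
        ENNReal.le_inv_iff_mul_le, mul_assoc, mul_comm (ρ f)]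
      exact (mul_le_mul_right hlt.le _).trans (ENNReal.inv_mul_cancel hσ0 hσf.ne).le
    · rw [cnorm, hσ.p2.congr (aemeasurable_enorm_aeeqFun F) hcf hF, hσ.q1.homogeneous c f hf, hc,
        ENNReal.inv_mul_cancel hσ0 hσf.ne]
  choose F hFρ hFσ using hex
  have h0mem : (0 : R →ₘ[μ] ℂ) ∈ space μ ρ := by
    have : ρ (fun x => ‖(0 : R →ₘ[μ] ℂ) x‖ₑ) = 0 :=
      (hρ.q1.eq_zero_iff _ (aemeasurable_enorm_aeeqFun _)).2
        (AEEqFun.coeFn_zero.mono fun x hx => by rw [hx, Pi.zero_apply, enorm_zero])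
    change ρ _ < ∞
    rw [this]; exact ENNReal.zero_lt_top
  have hFmem : ∀ n, F n ∈ space μ ρ := fun n =>
    (hFρ n).trans_lt (ENNReal.inv_lt_top.2 (by rw [ENNReal.coe_pos]; positivity))
  have hlim : Tendsto (fun n : ℕ => ((n + 1 : ℝ≥0) : ℝ≥0∞)⁻¹) atTop (𝓝 0) := by
    have := (tendsto_add_atTop_iff_nat 1).2 ENNReal.tendsto_inv_nat_nhds_zero
    refine this.congr fun n => ?_
    push_cast
    rfl
  have := h.2 F 0 hFmem h0mem (by
    simp only [sub_zero]
    exact tendsto_of_tendsto_of_tendsto_of_le_of_le tendsto_const_nhds hlim (fun _ => zero_le) hFρ)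
  simp only [sub_zero, hFσ] at this
  exact one_ne_zero (tendsto_nhds_unique tendsto_const_nhds this)

/-! ### The integrable associate norms -/

theorem sumNorm_hasP4 : HasP4 μ (sumNorm μ) := fun E _ _ => by
  refine (sumNorm_le_truncatedNorm_one μ _).trans_lt ?_
  rw [truncatedNorm_indicator]
  exact ENNReal.mul_lt_top (by simp) ((min_le_right _ _).trans_lt ENNReal.one_lt_top)

theorem sumNorm_hasP5 [SFinite μ] : HasP5 μ (sumNorm μ) := fun E hE hE' => by
  refine ⟨max 1 (μ E).toNNReal, fun f hf => ?_⟩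
  refine (setLIntegral_le_truncatedNorm μ hf hE).trans ((truncatedNorm_le μ hE'.ne f).trans ?_)
  rw [ENNReal.coe_max, ENNReal.coe_one, ENNReal.coe_toNNReal hE'.ne]
  gcongr
  exact truncatedNorm_one_le_sumNorm μ f

theorem integrableNorm_hasP4 (h : HasP4 μ ρ) : HasP4 μ (integrableNorm μ ρ) :=
  fun E hE hE' => max_lt (h E hE hE') (sumNorm_hasP4 E hE hE')

theorem integrableNorm_hasP5 [SFinite μ] : HasP5 μ (integrableNorm μ ρ) :=
  sumNorm_hasP5.of_dominatedBy DominatedBy.le_max_right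

/-- The second integrable associate norm is always a Banach function norm. -/
theorem secondIntegrableAssociateNorm_isBanachFunctionNorm [SigmaFinite μ] :
    IsBanachFunctionNorm μ (secondIntegrableAssociateNorm μ ρ) :=
  associateNorm_isBanachFunctionNorm
    (integrableNorm_hasP4 (associateNorm_hasP4 integrableNorm_hasP5)) integrableNorm_hasP5

/-- On a resonant space, `∫_0^{μ(E)} f^*` is the supremum of `∫ f h` over all `h` equimeasurable
with the characteristic function of `E`. -/
theorem IsResonant.iSup_eq_truncatedNorm (hμ : IsResonant μ) {E : Set R} (hE : MeasurableSet E)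
    {f : R → ℝ≥0∞} (hf : AEMeasurable f μ) :
    ⨆ (h : R → ℝ≥0∞) (_ : AEMeasurable h μ)
        (_ : ∀ s, distribution μ h s = distribution μ (E.indicator fun _ => 1) s),
      ∫⁻ x, f x * h x ∂μ = truncatedNorm μ (μ E) f := by
  rw [← lintegral_rearrangement_mul_indicator,
    ← hμ f _ hf (measurable_const.indicator hE).aemeasurable]
  simp only [rearrangement_eq_iff]

/-- (P5) for an r.i. functional on a resonant space implies the embedding into `L^1 + L^∞`. -/
theorem sumNorm_dominatedBy [SigmaFinite μ] (hμ : IsResonant μ)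
    (hri : IsRearrangementInvariant μ ρ) (h5 : HasP5 μ ρ) : DominatedBy μ (sumNorm μ) ρ := by
  obtain ⟨E, hE, hE', hE1⟩ := exists_measurableSet_min_one_le μ
  obtain ⟨C, hC⟩ := h5 E hE hE'
  refine ⟨2 * (C + 1), by positivity, fun f hf => ?_⟩
  have hm : AEMeasurable (E.indicator fun _ => (1 : ℝ≥0∞)) μ :=
    (measurable_const.indicator hE).aemeasurable
  -- Resonance with χ_E fixed and `f` running through its equimeasurable copies, all of the same
  -- norm ρ f.
  have key : truncatedNorm μ (μ E) f ≤ C * ρ f := by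
    rw [← lintegral_rearrangement_mul_indicator]
    simp only [mul_comm (rearrangement μ f _)]
    rw [← hμ _ f hm hf]
    refine iSup₂_le fun h hh => iSup_le fun heq => ?_
    rw [rearrangement_eq_iff] at heq
    rw [← hri h f hh hf heq]
    refine le_trans (le_of_eq ?_) (hC h hh)
    rw [← lintegral_indicator hE]
    congr with x
    by_cases hx : x ∈ E <;> simp [hx]
  calc sumNorm μ f ≤ 2 * truncatedNorm μ 1 f := sumNorm_le_truncatedNorm_one μ f
    _ ≤ 2 * ((C + 1) * ρ f) := by
        gcongr
        refine (truncatedNorm_one_le μ hE1 f).trans (key.trans ?_)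
        gcongr
        exact le_self_add
    _ = _ := by push_cast; ring

/-- The integrable associate space is embedded into `L^1 + L^∞`. -/
theorem sumNorm_dominatedBy_integrableAssociateNorm [SigmaFinite μ] (hμ : IsResonant μ)
    (hri : IsRearrangementInvariant μ ρ) (h4 : HasP4 μ ρ) :
    DominatedBy μ (sumNorm μ) (integrableAssociateNorm μ ρ) := by
  obtain ⟨E, hE, hE', hE1⟩ := exists_measurableSet_min_one_le μ
  have hm : AEMeasurable (E.indicator fun _ => (1 : ℝ≥0∞)) μ :=
    (measurable_const.indicator hE).aemeasurable
  have hfin := integrableNorm_hasP4 h4 E hE hE'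
  obtain ⟨C, hC⟩ : ∃ C : ℝ≥0, (C : ℝ≥0∞) = integrableNorm μ ρ (E.indicator fun _ => 1) :=
    ⟨_, ENNReal.coe_toNNReal hfin.ne⟩
  -- Here `f` stays fixed and χ_E runs through its equimeasurable copies, all of integrable norm
  -- `C`.
  have key : ∀ f, AEMeasurable f μ →
      truncatedNorm μ (μ E) f ≤ integrableAssociateNorm μ ρ f * C := by
    intro f hf
    rw [← hμ.iSup_eq_truncatedNorm hE hf]
    refine iSup₂_le fun h hh => iSup_le fun heq => ?_
    have hN : integrableNorm μ ρ h = C := by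
      rw [hC, integrableNorm, integrableNorm, hri h _ hh hm heq, wienerLuxemburg, wienerLuxemburg]
      have : rearrangement μ h = rearrangement μ (E.indicator fun _ => 1) := by
        ext t; simp only [rearrangement, heq]
      rw [this]
    rw [← hN]
    exact lintegral_mul_le_associateNorm f hh (integrableNorm_hasP5.eq_zero hh)
      (hN ▸ ENNReal.coe_lt_top)
  refine ⟨2 * (C + 1), by positivity, fun f hf => ?_⟩
  calc sumNorm μ f ≤ 2 * truncatedNorm μ 1 f := sumNorm_le_truncatedNorm_one μ f
    _ ≤ 2 * (integrableAssociateNorm μ ρ f * (C + 1)) := by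
        gcongr
        refine (truncatedNorm_one_le μ hE1 f).trans ((key f hf).trans ?_)
        gcongr
        exact le_self_add
    _ = _ := by push_cast; ring

/-- A norm is dominated by the second integrable associate norm. -/
theorem HasP1.dominatedBy_secondIntegrableAssociateNorm [SigmaFinite μ] (hμ : IsResonant μ)
    (hρ : IsRIQuasiBanachFunctionNorm μ ρ) (h1 : HasP1 μ ρ) :
    DominatedBy μ ρ (secondIntegrableAssociateNorm μ ρ) := by
  have hLL : DominatedBy μ ρ (associateNorm μ (associateNorm μ ρ)) :=
    .of_le fun f hf => le_associateNorm_associateNorm h1 hρ.quasiBanach.p2 hρ.quasiBanach.p3 hf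
  have hN : DominatedBy μ ρ (integrableNorm μ ρ) := DominatedBy.le_max_left
  have hT : DominatedBy μ (integrableNorm μ (integrableAssociateNorm μ ρ)) (associateNorm μ ρ) :=
    (DominatedBy.max_left (.of_le fun _ _ => le_rfl)
      (sumNorm_dominatedBy_integrableAssociateNorm hμ hρ.invariant hρ.quasiBanach.p4)).trans
      hN.associateNorm
  exact hLL.trans hT.associateNorm

/-- Dropping the L^1 + L^∞ term before the outer duality only enlarges the result, a second
associate never exceeds the original functional, and (P5) absorbs that term in the integrable norm
of ρ. -/
theorem HasP5.secondIntegrableAssociateNorm_dominatedBy [SigmaFinite μ] (hμ : IsResonant μ)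
    (hri : IsRearrangementInvariant μ ρ) (h5 : HasP5 μ ρ) :
    DominatedBy μ (secondIntegrableAssociateNorm μ ρ) ρ := by
  have h1 : DominatedBy μ (secondIntegrableAssociateNorm μ ρ)
      (associateNorm μ (associateNorm μ (integrableNorm μ ρ))) :=
    DominatedBy.associateNorm DominatedBy.le_max_left
  have h2 : DominatedBy μ (associateNorm μ (associateNorm μ (integrableNorm μ ρ)))
      (integrableNorm μ ρ) :=
    .of_le fun f hf => associateNorm_associateNorm_le
      (fun g hg => integrableNorm_hasP5.eq_zero hg) hf
  exact h1.trans (h2.trans (DominatedBy.max_left (.of_le fun _ _ => le_rfl)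
    (sumNorm_dominatedBy hμ hri h5)))

end RIFunctionSpace

namespace RIFunctionSpace

/-! ### Resonance of the half-line -/

theorem halfLine_Iic (x : ℝ) : halfLine (Iic x) = ENNReal.ofReal x := by
  rw [halfLine, Measure.restrict_apply measurableSet_Iic, inter_comm, Ici_inter_Iic,
    Real.volume_Icc, sub_zero]

theorem halfLine_univ : halfLine univ = ∞ := by
  rw [halfLine, Measure.restrict_apply_univ, Real.volume_Ici]

theorem halfLine_inter_Iic_ne_top (A : Set ℝ) (x : ℝ) : halfLine (A ∩ Iic x) ≠ ∞ :=
  ((measure_mono inter_subset_right).trans_lt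
    (by rw [halfLine_Iic]; exact ENNReal.ofReal_lt_top)).ne

theorem monotone_halfLine_inter_Iic (A : Set ℝ) : Monotone fun x => halfLine (A ∩ Iic x) :=
  fun _ _ h => measure_mono (inter_subset_inter_right _ (Iic_subset_Iic.2 h))

theorem lipschitzWith_halfLine_inter_Iic (A : Set ℝ) :
    LipschitzWith 1 fun x => (halfLine (A ∩ Iic x)).toReal := by
  refine LipschitzWith.of_le_add fun x y => ?_
  have hsub : A ∩ Iic x ⊆ (A ∩ Iic y) ∪ Ioc y x := fun z hz =>
    (le_or_gt z y).imp (fun h => ⟨hz.1, h⟩) fun h => ⟨h, hz.2⟩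
  have hle : halfLine (A ∩ Iic x) ≤ halfLine (A ∩ Iic y) + ENNReal.ofReal (dist x y) := by
    refine (measure_mono hsub).trans ((measure_union_le _ _).trans ?_)
    gcongr
    refine (Measure.restrict_apply_le _ _).trans ?_
    rw [Real.volume_Ioc]
    exact ENNReal.ofReal_le_ofReal (le_abs_self _)
  have := ENNReal.toReal_mono (by simp [halfLine_inter_Iic_ne_top]) hle
  rwa [ENNReal.toReal_add (halfLine_inter_Iic_ne_top A y) ENNReal.ofReal_ne_top,
    ENNReal.toReal_ofReal dist_nonneg] at this

/-- The measure of an initial piece of `A` depends continuously on its endpoint, so the intermediate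
value theorem applies. -/
theorem exists_halfLine_inter_Iic_eq {A : Set ℝ} {e : ℝ≥0∞} {x : ℝ}
    (hx : e ≤ halfLine (A ∩ Iic x)) : ∃ b, halfLine (A ∩ Iic b) = e := by
  have h0 : halfLine (A ∩ Iic 0) = 0 :=
    measure_mono_null inter_subset_right (by rw [halfLine_Iic, ENNReal.ofReal_zero])
  have he : e ≠ ∞ := (hx.trans_lt (halfLine_inter_Iic_ne_top A x).lt_top).ne
  rcases le_total x 0 with hx0 | hx0
  · refine ⟨0, ?_⟩
    have := hx.trans (monotone_halfLine_inter_Iic A hx0)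
    simp only [h0, nonpos_iff_eq_zero] at this
    rw [h0, this]
  have hmem : e.toReal ∈ Icc (halfLine (A ∩ Iic 0)).toReal (halfLine (A ∩ Iic x)).toReal :=
    ⟨by simp [h0], ENNReal.toReal_mono (halfLine_inter_Iic_ne_top A x) hx⟩
  obtain ⟨b, -, hb⟩ := intermediate_value_Icc hx0
    (lipschitzWith_halfLine_inter_Iic A).continuous.continuousOn hmem
  exact ⟨b, (ENNReal.toReal_eq_toReal_iff' (halfLine_inter_Iic_ne_top A b) he).1 hb⟩

theorem iSup_halfLine_inter_Iic (A : Set ℝ) :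
    ⨆ n : ℕ, halfLine (A ∩ Iic (n : ℝ)) = halfLine A := by
  have hmono : Monotone fun n : ℕ => A ∩ Iic (n : ℝ) := fun m n h =>
    inter_subset_inter_right _ (Iic_subset_Iic.2 (by exact_mod_cast h))
  rw [← hmono.measure_iUnion, ← inter_iUnion]
  congr 1
  refine inter_eq_left.2 fun x _ => ?_
  obtain ⟨n, hn⟩ := exists_nat_ge x
  exact mem_iUnion.2 ⟨n, hn⟩

theorem halfLine_setOf_halfLine_inter_Iic_lt {A : Set ℝ} {e : ℝ≥0∞} (he : e ≤ halfLine A) :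
    halfLine {x | x ∈ A ∧ halfLine (A ∩ Iic x) < e} = e := by
  apply le_antisymm
  · by_cases h : ∃ x, e ≤ halfLine (A ∩ Iic x)
    · obtain ⟨x, hx⟩ := h
      obtain ⟨b, hb⟩ := exists_halfLine_inter_Iic_eq hx
      conv_rhs => rw [← hb]
      refine measure_mono fun y hy => ⟨hy.1, ?_⟩
      by_contra hby
      exact (hb.symm.le.trans (monotone_halfLine_inter_Iic A (not_le.1 hby).le)).not_gt hy.2
    · push Not at h
      refine (measure_mono fun y hy => hy.1).trans ?_
      rw [← iSup_halfLine_inter_Iic]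
      exact iSup_le fun n => (h n).le
  -- The value `e` may be infinite or reached only in the limit, so the lower bound goes through
  -- every d < e.
  · refine le_of_forall_lt fun c hc => ?_
    obtain ⟨d, hcd, hde⟩ := exists_between hc
    have : d < ⨆ n : ℕ, halfLine (A ∩ Iic (n : ℝ)) := by
      rw [iSup_halfLine_inter_Iic]; exact hde.trans_le he
    obtain ⟨n, hn⟩ := lt_iSup_iff.1 this
    obtain ⟨b, hb⟩ := exists_halfLine_inter_Iic_eq hn.le
    refine hcd.trans_le (hb.symm.le.trans (measure_mono fun y hy => ⟨hy.1, ?_⟩))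
    exact ((monotone_halfLine_inter_Iic A hy.2).trans_eq hb).trans_lt hde

/-- The measure of the set of points at which `f` is larger than at `x`, where ties are broken
by position. -/
noncomputable def rank (f : ℝ → ℝ≥0∞) (x : ℝ) : ℝ≥0∞ :=
  halfLine {y | f x < f y ∨ (f x = f y ∧ y ≤ x)}

theorem measurable_rank {f : ℝ → ℝ≥0∞} (hf : Measurable f) : Measurable (rank f) := by
  have hs : MeasurableSet {q : ℝ × ℝ | f q.1 < f q.2 ∨ (f q.1 = f q.2 ∧ q.2 ≤ q.1)} := by
    rw [ofPred_or, ofPred_and]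
    exact (measurableSet_lt (by fun_prop) (by fun_prop)).union
      ((measurableSet_eq_fun (by fun_prop) (by fun_prop)).inter
        (measurableSet_le (by fun_prop) (by fun_prop)))
  exact measurable_measure_prodMk_left hs

theorem rank_le {f : ℝ → ℝ≥0∞} {v : ℝ≥0∞} {x : ℝ} (h : v < f x) :
    rank f x ≤ halfLine {y | v < f y} :=
  measure_mono fun _ hy => hy.elim (fun h' => h.trans h') fun h' => h.trans_eq h'.1

theorem le_rank {f : ℝ → ℝ≥0∞} {s : Set ℝ} {x : ℝ} (h : ∀ y ∈ s, f x < f y) :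
    halfLine s ≤ rank f x :=
  measure_mono fun y hy => Or.inl (h y hy)

theorem rank_eq {f : ℝ → ℝ≥0∞} (hf : Measurable f) (x : ℝ) :
    rank f x = halfLine {y | f x < f y} + halfLine ({y | f y = f x} ∩ Iic x) := by
  rw [← measure_union' _ (measurableSet_lt measurable_const hf)]
  · rw [rank]
    congr 1
    ext y
    simp [eq_comm]
  · rw [Set.disjoint_left]
    rintro y hy ⟨hy', -⟩
    simp only [mem_ofPred_eq] at hy hy'
    exact hy.ne' hy'

/-- Let v be the largest value with |{f ≥ v}| ≥ d. The points of rank below d are those of {f > v}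
together with an initial piece of {f = v} that supplies the missing measure d - |{f > v}|. -/
theorem halfLine_rank_lt {f : ℝ → ℝ≥0∞} (hf : Measurable f) (hfin : (range f).Finite)
    (d : ℝ≥0∞) : halfLine {x | rank f x < d} = d := by
  -- The value 0 is added so that a candidate always exists: {f ≥ 0} has infinite measure.
  have hVfin : {v | v ∈ insert 0 (range f) ∧ d ≤ halfLine {y | v ≤ f y}}.Finite :=
    (hfin.insert 0).subset fun v hv => hv.1
  obtain ⟨v, ⟨-, hvd⟩, hvmax⟩ := hVfin.exists_maximal
    ⟨0, mem_insert _ _, by simp [halfLine_univ]⟩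
  have hlt : ∀ x, v < f x → halfLine {y | v < f y} < d := by
    intro x hx
    obtain ⟨w, ⟨⟨z, rfl⟩, hwv⟩, hwmin⟩ :=
      (hfin.subset (inter_subset_left (t := Ioi v))).exists_minimal
      ⟨f x, mem_range_self x, hx⟩
    have hset : {y | v < f y} = {y | f z ≤ f y} := by
      ext y
      simp only [mem_ofPred_eq]
      refine ⟨fun hy => ?_, fun hy => lt_of_lt_of_le hwv hy⟩
      exact (le_total (f z) (f y)).elim id fun h => hwmin ⟨mem_range_self y, hy⟩ h
    rw [hset]
    by_contra! hle
    exact (lt_irrefl v) (lt_of_lt_of_le hwv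
      (hvmax ⟨mem_insert_of_mem _ (mem_range_self z), hle⟩ (le_of_lt hwv)))
  have hle : halfLine {y | v < f y} ≤ d := by
    by_cases h : ∃ x, v < f x
    · exact (hlt _ h.choose_spec).le
    · have : {y | v < f y} = ∅ := by
        ext y; simpa using fun hy => h ⟨y, hy⟩
      simp [this]
  have hms : MeasurableSet {y | v < f y} := measurableSet_lt measurable_const hf
  have hsum : halfLine {y | v ≤ f y} = halfLine {y | v < f y} + halfLine {y | f y = v} := by
    rw [← measure_union' _ hms]
    · congr 1
      ext y
      simp [le_iff_lt_or_eq, eq_comm]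
    · rw [Set.disjoint_left]
      intro y hy hy'
      simp only [mem_ofPred_eq] at hy hy'
      exact hy.ne' hy'
  have he : d - halfLine {y | v < f y} ≤ halfLine {y | f y = v} := by
    rw [tsub_le_iff_left, ← hsum]; exact hvd
  have hset : {x | rank f x < d} = {y | v < f y} ∪
      {x | x ∈ {y | f y = v} ∧
        halfLine ({y | f y = v} ∩ Iic x) < d - halfLine {y | v < f y}} := by
    ext x
    simp only [mem_ofPred_eq, mem_union]
    rcases lt_trichotomy v (f x) with h | h | h
    · simp only [h, true_or, iff_true]
      exact (rank_le h).trans_lt (hlt x h)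
    · subst h
      rw [rank_eq hf x]
      simp [lt_tsub_iff_left]
    · simp only [h.not_gt, h.ne, false_and, or_self, iff_false, not_lt]
      exact hvd.trans (le_rank fun y hy => h.trans_le hy)
  rw [hset, measure_union' _ hms, halfLine_setOf_halfLine_inter_Iic_lt he,
    add_tsub_cancel_of_le hle]
  rw [Set.disjoint_left]
  rintro y hy ⟨hy', -⟩
  simp only [mem_ofPred_eq] at hy hy'
  exact hy.ne' hy'

theorem rank_lt_top {f : ℝ → ℝ≥0∞} (hf : Measurable f)
    (hsupp : halfLine {x | 0 < f x} ≠ ∞) (x : ℝ) : rank f x < ∞ := by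
  rw [rank_eq hf]
  have hsub : {y | f x < f y} ⊆ {y | 0 < f y} := fun y hy => by
    rw [mem_ofPred_eq] at hy ⊢
    exact zero_le.trans_lt hy
  exact ENNReal.add_lt_top.2 ⟨(measure_mono hsub).trans_lt hsupp.lt_top,
    (halfLine_inter_Iic_ne_top _ _).lt_top⟩

/-- Rank decreases as `f` grows, so the two sets are nested and the intersection is the smaller one.
-/
theorem halfLine_inter_rank_lt {f : ℝ → ℝ≥0∞} (hf : Measurable f) (hfin : (range f).Finite)
    (s : ℝ≥0) (d : ℝ≥0∞) :
    halfLine ({x | (s : ℝ≥0∞) < f x} ∩ {x | rank f x < d}) = min (distribution halfLine f s) d := by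
  rcases le_or_gt d (distribution halfLine f s) with h | h
  · rw [min_eq_right h, inter_eq_right.2, halfLine_rank_lt hf hfin]
    intro x hx
    by_contra hs
    exact hx.not_ge (h.trans (le_rank fun y hy => lt_of_le_of_lt (not_lt.1 hs) hy))
  · rw [min_eq_left h.le, inter_eq_left.2, distribution]
    exact fun x hx => (rank_le hx).trans_lt h

/-- For simple functions of bounded support the supremum in the definition of resonance
is attained. -/
theorem exists_lintegral_mul_eq {f g : ℝ → ℝ≥0∞} (hf : Measurable f) (hfin : (range f).Finite)
    (hsupp : halfLine {x | 0 < f x} ≠ ∞) :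
    ∃ h : ℝ → ℝ≥0∞, Measurable h ∧ (∀ s, distribution halfLine h s = distribution halfLine g s) ∧
      ∫⁻ x, f x * h x ∂halfLine =
        ∫⁻ t, rearrangement halfLine f t * rearrangement halfLine g t ∂halfLine := by
  -- The maximiser is g^* composed with the rank: equimeasurable with `g`, and largest where `f` is
  -- largest.
  have hm : Measurable fun x => rearrangement halfLine g (rank f x).toReal :=
    (measurable_rearrangement halfLine g).comp (measurable_rank hf).ennreal_toReal
  have hset : ∀ s : ℝ≥0, {x | (s : ℝ≥0∞) < rearrangement halfLine g (rank f x).toReal} =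
      {x | rank f x < distribution halfLine g s} := fun s => by
    ext x
    rw [mem_ofPred_eq, mem_ofPred_eq, lt_rearrangement_iff,
      ENNReal.ofReal_toReal (rank_lt_top hf hsupp x).ne]
  refine ⟨_, hm, fun s => ?_, ?_⟩
  · rw [distribution, hset, halfLine_rank_lt hf hfin]
  · rw [lintegral_mul_eq_lintegral_lintegral _ hf.aemeasurable hm.aemeasurable,
      lintegral_rearrangement_mul]
    refine lintegral_congr fun s => lintegral_congr fun t => ?_
    rw [hset, halfLine_inter_rank_lt hf hfin]

theorem lintegral_mul_le_lintegral_rearrangement {R : Type*} [MeasurableSpace R] (μ : Measure R)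
    [SFinite μ] {f g : R → ℝ≥0∞} (hf : AEMeasurable f μ) (hg : AEMeasurable g μ) :
    ∫⁻ x, f x * g x ∂μ ≤ ∫⁻ t, rearrangement μ f t * rearrangement μ g t ∂halfLine := by
  rw [lintegral_mul_eq_lintegral_lintegral μ hf hg, lintegral_rearrangement_mul]
  exact lintegral_mono fun s => lintegral_mono fun t =>
    le_min (measure_mono inter_subset_left) (measure_mono inter_subset_right)

/-- Monotone convergence carries resonance from simple functions to all `f`. -/
theorem lintegral_rearrangement_mul_iSup {R : Type*} [MeasurableSpace R] (μ : Measure R)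
    {u : ℕ → R → ℝ≥0∞} (hu : Monotone u) (g : R → ℝ≥0∞) :
    ∫⁻ t, rearrangement μ (fun x => ⨆ n, u n x) t * rearrangement μ g t ∂halfLine =
      ⨆ n, ∫⁻ t, rearrangement μ (u n) t * rearrangement μ g t ∂halfLine := by
  simp only [lintegral_rearrangement_mul]
  have hd : ∀ s, distribution μ (fun x => ⨆ n, u n x) s = ⨆ n, distribution μ (u n) s := by
    intro s
    have hmono : Monotone fun n => {x | (s : ℝ≥0∞) < u n x} :=
      fun m n hmn x hx => lt_of_lt_of_le hx (hu hmn x)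
    simp only [distribution]
    rw [← hmono.measure_iUnion]
    congr 1
    ext x
    simp [lt_iSup_iff]
  have hdm : ∀ s, Monotone fun n => distribution μ (u n) s := fun s m k hmk =>
    distribution_mono (Eventually.of_forall fun x => hu hmk x) s
  rw [← lintegral_iSup]
  · refine lintegral_congr fun s => ?_
    rw [← lintegral_iSup]
    · refine lintegral_congr fun t => ?_
      rw [hd, iSup_inf_eq]
    · exact fun n => measurable_const.min (distribution_antitone μ g).measurable
    · exact fun m n hmn t => min_le_min_right _ (hdm s hmn)
  · exact fun n => Antitone.measurable fun s t hst => lintegral_mono fun r =>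
      min_le_min_right _ (distribution_antitone μ (u n) hst)
  · exact fun m n hmn s => lintegral_mono fun t => min_le_min_right _ (hdm s hmn)

theorem isResonant_halfLine : IsResonant halfLine := by
  intro f g hf hg
  simp only [rearrangement_eq_iff]
  apply le_antisymm
  · refine iSup₂_le fun h hh => iSup_le fun heq => ?_
    refine (lintegral_mul_le_lintegral_rearrangement halfLine hf hh).trans (le_of_eq ?_)
    have : rearrangement halfLine h = rearrangement halfLine g := by
      ext t; simp only [rearrangement, heq]
    rw [this]
  · obtain ⟨f', hf', hff⟩ := hf
    have hr : rearrangement halfLine f = rearrangement halfLine f' := by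
      ext t
      have : ∀ s, distribution halfLine f s = distribution halfLine f' s := fun s =>
        le_antisymm (distribution_mono (hff.mono fun x hx => hx.le) s)
          (distribution_mono (hff.mono fun x hx => hx.ge) s)
      simp only [rearrangement, this]
    -- Simple approximations cut off at n: finite range makes the rank measure preserving, and
    -- support of finite measure keeps it finite.
    set u : ℕ → ℝ → ℝ≥0∞ := fun n => (Iic (n : ℝ)).indicator (SimpleFunc.eapprox f' n) with hu
    have humono : Monotone u := fun m n hmn x =>
      (indicator_le_indicator_of_subset (Iic_subset_Iic.2 (by exact_mod_cast hmn))
        (fun _ => zero_le) x).trans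
        (indicator_le_indicator (SimpleFunc.monotone_eapprox f' hmn x))
    have hule : ∀ n x, u n x ≤ f' x := fun n x => by
      by_cases hx : x ∈ Iic (n : ℝ)
      · simp only [hu, indicator_of_mem hx]
        rw [← SimpleFunc.iSup_eapprox_apply hf' x]
        exact le_iSup (fun n => SimpleFunc.eapprox f' n x) n
      · simp [hu, indicator_of_notMem hx]
    have husup : f' = fun x => ⨆ n, u n x := by
      ext x
      refine le_antisymm ?_ (iSup_le fun n => hule n x)
      rw [← SimpleFunc.iSup_eapprox_apply hf' x]
      refine iSup_le fun n => ?_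
      obtain ⟨m, hm⟩ := exists_nat_ge x
      refine le_iSup_of_le (max m n) ?_
      have hx : x ∈ Iic ((max m n : ℕ) : ℝ) := hm.trans (by exact_mod_cast le_max_left _ _)
      simp only [hu, indicator_of_mem hx]
      exact SimpleFunc.monotone_eapprox f' (le_max_right m n) x
    have hL : ∫⁻ t, rearrangement halfLine f t * rearrangement halfLine g t ∂halfLine =
        ⨆ n, ∫⁻ t, rearrangement halfLine (u n) t * rearrangement halfLine g t ∂halfLine := by
      rw [hr, husup, lintegral_rearrangement_mul_iSup halfLine humono g]
    rw [hL]
    refine iSup_le fun n => ?_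
    obtain ⟨h, hh, heq, hint⟩ := exists_lintegral_mul_eq (f := u n) (g := g)
      ((SimpleFunc.measurable _).indicator measurableSet_Iic)
      (((SimpleFunc.eapprox f' n).finite_range.insert 0).subset (by
        rintro _ ⟨x, rfl⟩
        by_cases hx : x ∈ Iic (n : ℝ)
        · simp only [hu, indicator_of_mem hx]
          exact mem_insert_of_mem _ (mem_range_self x)
        · simp only [hu, indicator_of_notMem hx]
          exact mem_insert _ _))
      (lt_of_le_of_lt (measure_mono (t := Iic (n : ℝ)) fun x hx => by
        by_contra hn
        simp [hu, indicator_of_notMem hn] at hx)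
        (by rw [halfLine_Iic]; exact ENNReal.ofReal_lt_top)).ne
    rw [← hint]
    refine le_iSup₂_of_le h hh.aemeasurable (le_iSup_of_le heq ?_)
    refine lintegral_mono_ae (hff.mono fun x hx => ?_)
    rw [hx]
    gcongr
    exact hule n x

/-! ### Lebesgue spaces with exponent below one -/

section Lebesgue

variable {R : Type*} [MeasurableSpace R] {μ : Measure R} {p : ℝ}

theorem lebesgueNorm_ofReal (hp : 0 < p) (f : R → ℝ≥0∞) :
    lebesgueNorm μ (ENNReal.ofReal p) f = (∫⁻ x, f x ^ p ∂μ) ^ (1 / p) := by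
  rw [lebesgueNorm, eLpNorm_eq_lintegral_rpow_enorm_toReal (by simpa using hp) (by simp)]
  simp only [ENNReal.toReal_ofReal hp.le, enorm_eq_self]

theorem lebesgueNorm_indicator (hp : 0 < p) {E : Set R} (hE : MeasurableSet E) :
    lebesgueNorm μ (ENNReal.ofReal p) (E.indicator fun _ => 1) = μ E ^ (1 / p) := by
  rw [lebesgueNorm_ofReal hp, ← lintegral_indicator_one hE]
  congr 2 with x
  by_cases hx : x ∈ E <;> simp [hx, hp]

theorem lebesgueNorm_homogeneous (hp : 0 < p) (a : ℝ≥0) (f : R → ℝ≥0∞) :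
    lebesgueNorm μ (ENNReal.ofReal p) (fun x => a * f x) =
      a * lebesgueNorm μ (ENNReal.ofReal p) f := by
  simp only [lebesgueNorm_ofReal hp, ENNReal.mul_rpow_of_nonneg _ _ hp.le]
  rw [lintegral_const_mul' _ _ (ENNReal.rpow_ne_top_of_nonneg hp.le ENNReal.coe_ne_top),
    ENNReal.mul_rpow_of_nonneg _ _ (by positivity), ← ENNReal.rpow_mul, mul_one_div_cancel hp.ne',
    ENNReal.rpow_one]

theorem lebesgueNorm_isRIQuasiBanachFunctionNorm [SFinite μ] (hp : 0 < p) (hp1 : p < 1) :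
    IsRIQuasiBanachFunctionNorm μ (lebesgueNorm μ (ENNReal.ofReal p)) where
  quasiBanach :=
    { q1 :=
      { homogeneous := fun a f _ => lebesgueNorm_homogeneous hp a f
        eq_zero_iff := fun f hf => by
          rw [lebesgueNorm_ofReal hp, ENNReal.rpow_eq_zero_iff_of_pos (by positivity),
            lintegral_eq_zero_iff' (hf.pow_const p)]
          refine eventually_congr (Eventually.of_forall fun x => ?_)
          exact ENNReal.rpow_eq_zero_iff_of_pos hp
        quasi_subadditive := by
          have h1 : 1 < 1 / p := (one_lt_div hp).2 hp1
          refine ⟨2 ^ (1 / p - 1), NNReal.one_le_rpow one_le_two (by linarith), fun f g hf _ => ?_⟩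
          simp only [lebesgueNorm_ofReal hp]
          rw [ENNReal.coe_rpow_of_nonneg _ (by linarith), ENNReal.coe_ofNat]
          exact ENNReal.lintegral_Lp_add_le_of_le_one hf hp.le hp1.le }
      p2 := fun f g _ _ h => by
        simp only [lebesgueNorm_ofReal hp]
        refine ENNReal.rpow_le_rpow (lintegral_mono_ae ?_) (by positivity)
        exact h.mono fun x hx => ENNReal.rpow_le_rpow hx hp.le
      p3 := fun u f hu _ h => by
        simp only [lebesgueNorm_ofReal hp]
        refine ⟨fun m n hmn => ?_, ?_⟩
        · refine ENNReal.rpow_le_rpow (lintegral_mono_ae ?_) (by positivity)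
          exact h.mono fun x hx => ENNReal.rpow_le_rpow (hx.1 hmn) hp.le
        · refine (ENNReal.continuous_rpow_const.tendsto _).comp ?_
          refine lintegral_tendsto_of_tendsto_of_monotone (fun n => (hu n).pow_const p)
            (h.mono fun x hx m n hmn => ENNReal.rpow_le_rpow (hx.1 hmn) hp.le)
            (h.mono fun x hx => (ENNReal.continuous_rpow_const.tendsto _).comp hx.2)
      p4 := fun E hE hE' => by
        rw [lebesgueNorm_indicator hp hE]
        exact ENNReal.rpow_lt_top_of_nonneg (by positivity) hE'.ne }
  invariant := fun f g hf hg h => by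
    have hd : ∀ (k : R → ℝ≥0∞) (s : ℝ≥0),
        distribution μ (fun x => k x ^ p) s = distribution μ k (s ^ p⁻¹) := fun k s => by
      simp only [distribution]
      congr 1
      ext x
      rw [mem_ofPred_eq, mem_ofPred_eq, ENNReal.coe_rpow_of_nonneg _ (by positivity),
        ENNReal.rpow_inv_lt_iff hp]
    rw [lebesgueNorm_ofReal hp, lebesgueNorm_ofReal hp,
      lintegral_eq_lintegral_distribution μ (hf.pow_const p),
      lintegral_eq_lintegral_distribution μ (hg.pow_const p)]
    simp only [hd, h]

end Lebesgue

variable {p : ℝ}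

/-- The characteristic functions of [0,1) and [1,2) would give 2^(1/p) ≤ 2. -/
theorem not_hasP1_lebesgueNorm (hp : 0 < p) (hp1 : p < 1) :
    ¬ HasP1 halfLine (lebesgueNorm halfLine (ENNReal.ofReal p)) := by
  intro h
  have hv : ∀ a b : ℝ, 0 ≤ a → halfLine (Ico a b) = ENNReal.ofReal (b - a) := fun a b ha => by
    rw [halfLine, Measure.restrict_apply measurableSet_Ico, inter_eq_left.2, Real.volume_Ico]
    exact fun x hx => ha.trans hx.1
  have hadd : (fun x => (Ico (0 : ℝ) 1).indicator (fun _ => (1 : ℝ≥0∞)) x +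
      (Ico (1 : ℝ) 2).indicator (fun _ => 1) x) = (Ico (0 : ℝ) 2).indicator fun _ => 1 := by
    rw [← Ico_union_Ico_eq_Ico (zero_le_one' ℝ) one_le_two,
      indicator_union_of_disjoint (Ico_disjoint_Ico_same)]
  have := h.subadditive ((Ico (0 : ℝ) 1).indicator fun _ => 1)
    ((Ico (1 : ℝ) 2).indicator fun _ => 1)
    (measurable_const.indicator measurableSet_Ico).aemeasurable
    (measurable_const.indicator measurableSet_Ico).aemeasurable
  rw [hadd, lebesgueNorm_indicator hp measurableSet_Ico,
    lebesgueNorm_indicator hp measurableSet_Ico,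
    lebesgueNorm_indicator hp measurableSet_Ico, hv 0 2 le_rfl, hv 0 1 le_rfl, hv 1 2 zero_le_one]
    at this
  norm_num at this
  have hlt := ENNReal.rpow_lt_rpow_of_exponent_lt ENNReal.one_lt_two ENNReal.ofNat_ne_top
    ((one_lt_inv₀ hp).2 hp1)
  rw [ENNReal.rpow_one] at hlt
  exact this.not_gt hlt

/-! ### Power functions and the two non-inclusions for L^p -/

theorem setLIntegral_ofReal_lt_top_iff {E : Set ℝ} (hE : MeasurableSet E) (hE0 : E ⊆ Ioi 0)
    (r : ℝ) : ∫⁻ x in E, ENNReal.ofReal (x ^ r) ∂halfLine < ∞ ↔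
      IntegrableOn (fun x => x ^ r) E := by
  have hres : halfLine.restrict E = volume.restrict E := by
    rw [halfLine, Measure.restrict_restrict hE, inter_eq_left.2 (hE0.trans Ioi_subset_Ici_self)]
  have hm : AEStronglyMeasurable (fun x : ℝ => x ^ r) (volume.restrict E) :=
    (measurable_id.pow_const r).aestronglyMeasurable
  rw [hres, IntegrableOn, Integrable, and_iff_right hm, hasFiniteIntegral_iff_ofReal]
  exact (ae_restrict_mem hE).mono fun x hx => Real.rpow_nonneg (le_of_lt (hE0 hx)) r

/-- The function `x ^ r` on the set `E`. -/
noncomputable def powerOn (E : Set ℝ) (r : ℝ) : ℝ → ℝ≥0∞ :=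
  E.indicator fun x => ENNReal.ofReal (x ^ r)

theorem measurable_powerOn {E : Set ℝ} (hE : MeasurableSet E) (r : ℝ) :
    Measurable (powerOn E r) :=
  ((measurable_id.pow_const r).ennreal_ofReal).indicator hE

theorem powerOn_lt_top (E : Set ℝ) (r x : ℝ) : powerOn E r x < ∞ := by
  by_cases hx : x ∈ E <;> simp [powerOn, hx]

theorem lebesgueNorm_powerOn_lt_top_iff (hp : 0 < p) {E : Set ℝ} (hE : MeasurableSet E)
    (hE0 : E ⊆ Ioi 0) (r : ℝ) :
    lebesgueNorm halfLine (ENNReal.ofReal p) (powerOn E r) < ∞ ↔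
      IntegrableOn (fun x => x ^ (r * p)) E := by
  rw [lebesgueNorm_ofReal hp, ENNReal.rpow_lt_top_iff_of_pos (by positivity),
    ← setLIntegral_ofReal_lt_top_iff hE hE0, ← lintegral_indicator hE]
  suffices h : ∀ x, powerOn E r x ^ p = E.indicator (fun x => ENNReal.ofReal (x ^ (r * p))) x by
    simp only [h]
  intro x
  by_cases hx : x ∈ E
  · have hx0 : 0 < x := hE0 hx
    rw [powerOn, indicator_of_mem hx, indicator_of_mem hx,
      ENNReal.ofReal_rpow_of_nonneg (by positivity) hp.le, Real.rpow_mul hx0.le]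
  · simp [powerOn, hx, hp]

theorem lintegral_powerOn_lt_top_iff {E : Set ℝ} (hE : MeasurableSet E)
    (hE0 : E ⊆ Ioi 0) (r : ℝ) :
    ∫⁻ x, powerOn E r x ∂halfLine < ∞ ↔ IntegrableOn (fun x => x ^ r) E := by
  rw [← setLIntegral_ofReal_lt_top_iff hE hE0, ← lintegral_indicator hE]
  rfl

/-- A function in `L^p` which is not locally integrable. -/
theorem exists_lebesgueNorm_lt_top_not_integrable (hp : 0 < p) (hp1 : p < 1) :
    ∃ f : ℝ → ℝ≥0∞, Measurable f ∧ (∀ x, f x < ∞) ∧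
      lebesgueNorm halfLine (ENNReal.ofReal p) f < ∞ ∧ ∫⁻ x in Ioo 0 1, f x ∂halfLine = ∞ := by
  have hE0 : Ioo (0 : ℝ) 1 ⊆ Ioi 0 := fun x hx => hx.1
  refine ⟨powerOn (Ioo 0 1) (-1), measurable_powerOn measurableSet_Ioo _,
    powerOn_lt_top _ _, ?_, ?_⟩
  · rw [lebesgueNorm_powerOn_lt_top_iff hp measurableSet_Ioo hE0,
      intervalIntegral.integrableOn_Ioo_rpow_iff one_pos]
    linarith
  · by_contra hne
    have hlt := lt_top_iff_ne_top.2 hne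
    rw [← lintegral_indicator measurableSet_Ioo] at hlt
    have : (Ioo (0 : ℝ) 1).indicator (powerOn (Ioo 0 1) (-1)) = powerOn (Ioo 0 1) (-1) := by
      rw [powerOn, indicator_indicator, inter_self]
    rw [this, lintegral_powerOn_lt_top_iff measurableSet_Ioo hE0,
      intervalIntegral.integrableOn_Ioo_rpow_iff one_pos] at hlt
    exact lt_irrefl _ hlt

theorem not_hasP5_lebesgueNorm (hp : 0 < p) (hp1 : p < 1) :
    ¬ HasP5 halfLine (lebesgueNorm halfLine (ENNReal.ofReal p)) := by
  intro h
  obtain ⟨f, hf, -, hfp, hfi⟩ := exists_lebesgueNorm_lt_top_not_integrable hp hp1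
  obtain ⟨C, hC⟩ := h (Ioo 0 1) measurableSet_Ioo
    (lt_of_le_of_lt (Measure.restrict_apply_le _ _) (by simp))
  have := hC f hf.aemeasurable
  rw [hfi] at this
  exact this.not_gt (ENNReal.mul_lt_top ENNReal.coe_lt_top hfp)

/-- The norm of X_i'' has (P5), so its space contains only functions integrable on (0,1). -/
theorem not_space_lebesgueNorm_subset (hp : 0 < p) (hp1 : p < 1) :
    ¬ space halfLine (lebesgueNorm halfLine (ENNReal.ofReal p)) ⊆
      space halfLine (secondIntegrableAssociateNorm halfLine
        (lebesgueNorm halfLine (ENNReal.ofReal p))) := by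
  intro hsub
  obtain ⟨f, hf, hfin, hfp, hfi⟩ := exists_lebesgueNorm_lt_top_not_integrable hp hp1
  obtain ⟨F, hF⟩ := exists_aeeqFun_enorm_eq hf.aemeasurable (μ := halfLine)
    (Eventually.of_forall hfin)
  have hLp := lebesgueNorm_isRIQuasiBanachFunctionNorm (μ := halfLine) hp hp1
  have hB := secondIntegrableAssociateNorm_isBanachFunctionNorm (μ := halfLine)
    (ρ := lebesgueNorm halfLine (ENNReal.ofReal p))
  have hmem : F ∈ space halfLine (lebesgueNorm halfLine (ENNReal.ofReal p)) := by
    change lebesgueNorm _ _ _ < ∞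
    rwa [hLp.quasiBanach.p2.congr (aemeasurable_enorm_aeeqFun F) hf.aemeasurable hF]
  have hmem' := hsub hmem
  change secondIntegrableAssociateNorm _ _ _ < ∞ at hmem'
  rw [hB.p2.congr (aemeasurable_enorm_aeeqFun F) hf.aemeasurable hF] at hmem'
  obtain ⟨C, hC⟩ := hB.p5 (Ioo 0 1) measurableSet_Ioo
    (lt_of_le_of_lt (Measure.restrict_apply_le _ _) (by simp))
  have := hC f hf.aemeasurable
  rw [hfi] at this
  exact this.not_gt (ENNReal.mul_lt_top ENNReal.coe_lt_top hmem')

/-- The essential supremum is dominated by the integrable associate norm of `L^p`. -/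
theorem ae_le_integrableAssociateNorm_lebesgueNorm (hp : 0 < p) (hp1 : p < 1) {g : ℝ → ℝ≥0∞}
    (hg : AEMeasurable g halfLine) : ∀ᵐ x ∂halfLine,
      g x ≤ 2 * integrableAssociateNorm halfLine (lebesgueNorm halfLine (ENNReal.ofReal p)) g := by
  set N := integrableNorm halfLine (lebesgueNorm halfLine (ENNReal.ofReal p)) with hN
  set A := integrableAssociateNorm halfLine (lebesgueNorm halfLine (ENNReal.ofReal p)) g with hA
  obtain ⟨g', hg', hgg⟩ := hg
  have key : ∀ k : ℕ, halfLine ({x | 2 * A < g' x} ∩ Ico (k : ℝ) (k + 1)) = 0 := by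
    intro k
    by_contra hne
    set E := {x | 2 * A < g' x} ∩ Ico (k : ℝ) (k + 1) with hEdef
    have hE : MeasurableSet E := (measurableSet_lt measurable_const hg').inter measurableSet_Ico
    have hE1 : halfLine E ≤ 1 := by
      refine (measure_mono inter_subset_right).trans ((Measure.restrict_apply_le _ _).trans ?_)
      rw [Real.volume_Ico]
      simp
    have hEfin : halfLine E ≠ ∞ := (hE1.trans_lt ENNReal.one_lt_top).ne
    have hm : AEMeasurable (E.indicator fun _ => (1 : ℝ≥0∞)) halfLine :=
      (measurable_const.indicator hE).aemeasurable
    -- Cutting to unit intervals gives |E| ≤ 1, hence |E|^(1/p) ≤ |E|. The factor 2 comes from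
    -- comparing `sumNorm` with the truncated norm.
    have hNE : N (E.indicator fun _ => 1) ≤ 2 * halfLine E := by
      refine max_le ?_ ((sumNorm_le_truncatedNorm_one _ _).trans ?_)
      · rw [lebesgueNorm_indicator hp hE, two_mul]
        refine le_trans ?_ le_self_add
        calc halfLine E ^ (1 / p) ≤ halfLine E ^ (1 : ℝ) :=
              ENNReal.rpow_le_rpow_of_exponent_ge hE1 ((one_lt_div hp).2 hp1).le
          _ = halfLine E := ENNReal.rpow_one _
      · rw [truncatedNorm_indicator]
        gcongr
        exact min_le_left _ _
    have hNlt : N (E.indicator fun _ => 1) < ∞ :=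
      hNE.trans_lt (ENNReal.mul_lt_top (by simp) hEfin.lt_top)
    have hle : ∫⁻ x in E, g' x ∂halfLine ≤ A * (2 * halfLine E) := by
      refine le_trans (le_of_eq ?_) ((lintegral_mul_le_associateNorm g hm
        (integrableNorm_hasP5.eq_zero hm) hNlt).trans (mul_le_mul_right hNE _))
      rw [← lintegral_indicator hE]
      refine lintegral_congr_ae (hgg.mono fun x hx => ?_)
      by_cases hxE : x ∈ E <;> simp [hxE, hx]
    have hlt : ∫⁻ _ in E, 2 * A ∂halfLine < ∫⁻ x in E, g' x ∂halfLine := by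
      refine setLIntegral_strict_mono hE hne hg' ?_ (Eventually.of_forall fun x hx => hx.1)
      rw [setLIntegral_const]
      refine ENNReal.mul_ne_top ?_ hEfin
      obtain ⟨x, hx⟩ := nonempty_of_measure_ne_zero hne
      exact (lt_of_lt_of_le hx.1 le_top).ne
    rw [setLIntegral_const] at hlt
    refine hlt.not_ge (hle.trans (le_of_eq ?_))
    ring
  have hneg : ∀ᵐ x ∂halfLine, x ∈ Ici (0 : ℝ) := ae_restrict_mem measurableSet_Ici
  have hall : ∀ᵐ x ∂halfLine, ∀ k : ℕ, x ∉ {x | 2 * A < g' x} ∩ Ico (k : ℝ) (k + 1) :=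
    ae_all_iff.2 fun k => measure_eq_zero_iff_ae_notMem.1 (key k)
  filter_upwards [hgg, hneg, hall] with x hx hx0 hxk
  rw [hx]
  by_contra! hlt
  exact hxk ⌊x⌋₊ ⟨hlt, Nat.floor_le hx0, Nat.lt_floor_add_one x⟩

/-- The integrable associate norm controls the essential supremum, so the next associate is
controlled by L^1. -/
theorem secondIntegrableAssociateNorm_lebesgueNorm_le (hp : 0 < p) (hp1 : p < 1)
    {f : ℝ → ℝ≥0∞} (hf : AEMeasurable f halfLine) :
    secondIntegrableAssociateNorm halfLine (lebesgueNorm halfLine (ENNReal.ofReal p)) f ≤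
      2 * ∫⁻ x, f x ∂halfLine := by
  refine associateNorm_le fun g hg _ => ENNReal.div_le_of_le_mul ?_
  calc ∫⁻ x, f x * g x ∂halfLine
      ≤ ∫⁻ x, f x * (2 * integrableAssociateNorm halfLine
          (lebesgueNorm halfLine (ENNReal.ofReal p)) g) ∂halfLine :=
        lintegral_mono_ae ((ae_le_integrableAssociateNorm_lebesgueNorm hp hp1 hg).mono
          fun x hx => by gcongr)
    _ = 2 * (∫⁻ x, f x ∂halfLine) * integrableAssociateNorm halfLine
          (lebesgueNorm halfLine (ENNReal.ofReal p)) g := by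
        rw [lintegral_mul_const'' _ hf]; ring
    _ ≤ _ := by
        gcongr
        exact le_max_left _ _

theorem not_space_secondIntegrableAssociateNorm_subset (hp : 0 < p) (hp1 : p < 1) :
    ¬ space halfLine (secondIntegrableAssociateNorm halfLine
        (lebesgueNorm halfLine (ENNReal.ofReal p))) ⊆
      space halfLine (lebesgueNorm halfLine (ENNReal.ofReal p)) := by
  intro hsub
  have hE0 : Ioi (1 : ℝ) ⊆ Ioi 0 := Ioi_subset_Ioi zero_le_one
  -- On (1,∞) this power is integrable since 1/p > 1, while its p-th power is 1/x.
  have hf := measurable_powerOn measurableSet_Ioi (E := Ioi (1 : ℝ)) (-p⁻¹)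
  obtain ⟨F, hF⟩ := exists_aeeqFun_enorm_eq hf.aemeasurable (μ := halfLine)
    (Eventually.of_forall (powerOn_lt_top _ _))
  have hLp := lebesgueNorm_isRIQuasiBanachFunctionNorm (μ := halfLine) hp hp1
  have hmem : F ∈ space halfLine (secondIntegrableAssociateNorm halfLine
      (lebesgueNorm halfLine (ENNReal.ofReal p))) := by
    refine (secondIntegrableAssociateNorm_lebesgueNorm_le hp hp1
      (aemeasurable_enorm_aeeqFun F)).trans_lt (ENNReal.mul_lt_top (by simp) ?_)
    rw [lintegral_congr_ae hF, lintegral_powerOn_lt_top_iff measurableSet_Ioi hE0,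
      integrableOn_Ioi_rpow_iff one_pos]
    have := (one_lt_inv₀ hp).2 hp1
    linarith
  have hmem' := hsub hmem
  change lebesgueNorm _ _ _ < ∞ at hmem'
  rw [hLp.quasiBanach.p2.congr (aemeasurable_enorm_aeeqFun F) hf.aemeasurable hF,
    lebesgueNorm_powerOn_lt_top_iff hp measurableSet_Ioi hE0, integrableOn_Ioi_rpow_iff one_pos,
    neg_mul, inv_mul_cancel₀ hp.ne'] at hmem'
  exact lt_irrefl _ hmem'

end RIFunctionSpace

open RIFunctionSpace in
theorem mainTheorem7 {R : Type*} [MeasurableSpace R] (μ : Measure R) [SigmaFinite μ]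
    (hμ : IsResonant μ) (ρ : (R → ℝ≥0∞) → ℝ≥0∞) (hρ : IsRIQuasiBanachFunctionNorm μ ρ) :
    (IsBanachFunctionNorm μ ρ →
      space μ ρ = space μ (secondIntegrableAssociateNorm μ ρ) ∧
      Equivalent μ ρ (secondIntegrableAssociateNorm μ ρ)) ∧
    (HasP5 μ ρ → (¬ ∃ σ : (R → ℝ≥0∞) → ℝ≥0∞, IsBanachFunctionNorm μ σ ∧ Equivalent μ ρ σ) →
      Embeds μ ρ (secondIntegrableAssociateNorm μ ρ) ∧
      ¬ Embeds μ (secondIntegrableAssociateNorm μ ρ) ρ) ∧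
    (HasP1 μ ρ → ¬ HasP5 μ ρ →
      Embeds μ (secondIntegrableAssociateNorm μ ρ) ρ ∧
      ¬ Embeds μ ρ (secondIntegrableAssociateNorm μ ρ)) ∧
    (IsResonant halfLine ∧ ∀ p : ℝ, 0 < p → p < 1 →
      IsRIQuasiBanachFunctionNorm halfLine (lebesgueNorm halfLine (ENNReal.ofReal p)) ∧
      ¬ HasP1 halfLine (lebesgueNorm halfLine (ENNReal.ofReal p)) ∧
      ¬ HasP5 halfLine (lebesgueNorm halfLine (ENNReal.ofReal p)) ∧
      ¬ space halfLine (lebesgueNorm halfLine (ENNReal.ofReal p)) ⊆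
        space halfLine (secondIntegrableAssociateNorm halfLine
          (lebesgueNorm halfLine (ENNReal.ofReal p))) ∧
      ¬ space halfLine (secondIntegrableAssociateNorm halfLine
          (lebesgueNorm halfLine (ENNReal.ofReal p))) ⊆
        space halfLine (lebesgueNorm halfLine (ENNReal.ofReal p))) := by
  refine ⟨fun hB => ?_, fun h5 hne => ⟨?_, fun hE => hne ?_⟩, fun h1 h5 => ⟨?_, fun hE => h5 ?_⟩,
    isResonant_halfLine, fun p hp hp1 => ⟨lebesgueNorm_isRIQuasiBanachFunctionNorm hp hp1,
      not_hasP1_lebesgueNorm hp hp1, not_hasP5_lebesgueNorm hp hp1,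
      not_space_lebesgueNorm_subset hp hp1, not_space_secondIntegrableAssociateNorm_subset hp hp1⟩⟩
  · have hequiv := (hB.p1.dominatedBy_secondIntegrableAssociateNorm hμ hρ).equivalent
      (hB.p5.secondIntegrableAssociateNorm_dominatedBy hμ hρ.invariant)
    exact ⟨hequiv.space_eq, hequiv⟩
  · exact (h5.secondIntegrableAssociateNorm_dominatedBy hμ hρ.invariant).embeds
  · have hBan := secondIntegrableAssociateNorm_isBanachFunctionNorm (μ := μ) (ρ := ρ)
    exact ⟨_, hBan, (hBan.isQuasiBanachFunctionNorm.dominatedBy_of_embeds hρ.quasiBanach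
      hE).equivalent (h5.secondIntegrableAssociateNorm_dominatedBy hμ hρ.invariant)⟩
  · exact (h1.dominatedBy_secondIntegrableAssociateNorm hμ hρ).embeds
  · have hBan := secondIntegrableAssociateNorm_isBanachFunctionNorm (μ := μ) (ρ := ρ)
    exact hBan.p5.of_dominatedBy
      (hρ.quasiBanach.dominatedBy_of_embeds hBan.isQuasiBanachFunctionNorm hE)
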